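/- Let $\mathbb K$ be a field of characteristic $0$; all vector spaces are $\mathbb Z$-graded over $\mathbb K$. An $A_\infty[1]$-algebra is a graded vector space $A$ with degree $1$ maps $\mu_k:A^{\otimes k}\to A$ ($k\ge1$) such that for all $n\ge 1$ and homogeneous $a_1,\dots,a_n$ $$\sum_{i+l+t=n,\ l\ge1}(-1)^{|a_1|+\cdots+|a_i|}\mu_{i+1+t}(a_1,\dots,a_i,\mu_l(a_{i+1},\dots,a_{i+l}),a_{i+l+1},\dots,a_n)=0 .$$ A bimodule over it is a graded vector space $M$ with degree $1$ maps $\eta_k$ ($k\ge1$), defined on the $k$-fold tensor products with exactly one factor $M$ and all other factors $A$, with values in $M$, satisfying the same identities when exactly one of $a_1,\dots,a_n$ is in $M$, each $\mu$ having an argument in $M$ being replaced by $\eta$. Let $\overline T(V)=\bigoplus_{k\ge1}V^{\otimes k}$, and let $\mathrm{Hom}_n(\overline T(V),W)$ be the space of families $(f_k)_{k\ge1}$ of degree $n$ linear maps $f_k:V^{\otimes k}\to W$. Let $L=\bigoplus_n\mathrm{Hom}_n(\overline T(A\oplus M),A\oplus M)$ with the graded Lie bracket $[f,g]=f\circ g-(-1)^{|f||g|}g\circ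 f$, where $$(f\circ g)_N(v_1,\dots,v_N)=\sum_{i+l+t=N,\ l\ge1}(-1)^{|g|(|v_1|+\cdots+|v_i|)}f_{i+1+t}(v_1,\dots,v_i,g_l(v_{i+1},\dots,v_{i+l}),v_{i+l+1},\dots,v_N),$$ let $\mathfrak a=\bigoplus_n\mathrm{Hom}_n(\overline T(M),A)\subset L$, let $P:L\to\mathfrak a$ be the projection, and let $\triangle=\sum_k(\mu_k+\eta_k)$. The derived brackets $l_k(a_1,\dots,a_k)=P[\cdots[[\triangle,a_1],a_2],\dots,a_k]$ are the structure maps of the derived-bracket $L_\infty[1]$-algebra on $\mathfrak a$, which is filtered by $\mathcal F_n\mathfrak a=\{f: f_k=0\text{ for }k<n\}$. A degree $0$ element $T=(T_k)_{k\ge 1}$ of $\mathfrak a$ is called a homotopy relative Rota–Baxter operator if it is a Maurer–Cartan element, i.e. $\sum_{k\ge1}\frac1{k!}l_k(T,\dots,T)=0$, the sum being taken in the topology of the filtration. **Proposition.** Let $A$ be an $A_\infty[1]$-algebra, $M$ a bimodule over it and $T=\sum_kT_k\in\mathrm{Hom}_0(\overline T(M),A)$. Then $T$ is a homotopy relative Rota–Baxter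 operator if and only if for every $p\ge1$ and all homogeneous $u_1,\dots,u_p\in M$ $$\sum_{n\ge 1}\ \sum_{k_1+\cdots+k_n=p}\mu_n\big(T_{k_1}(u_1,\dots,u_{k_1}),\dots,T_{k_n}(u_{k_1+\cdots+k_{n-1}+1},\dots,u_p)\big)$$ $$=\sum_{n\ge1}\sum_{i=1}^n\ \sum_{j+k_1+\cdots+k_{i-1}+1+k_{i+1}+\cdots+k_n+t=p}(-1)^{|u_1|+\cdots+|u_j|}\,T_{j+1+t}\Big(u_1,\dots,u_j,\ \eta_n\big(T_{k_1}(u_{j+1},\dots,u_{j+k_1}),\dots,T_{k_{i-1}}(\dots),\ u_{j+k_1+\cdots+k_{i-1}+1},\ T_{k_{i+1}}(\dots),\dots,T_{k_n}(\dots,u_{p-t})\big),\ u_{p-t+1},\dots,u_p\Big),$$ where all $k_r\ge1$ and $j,t\ge0$. -/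

import Mathlib

open Filter

/-- A family of multilinear maps `f k : V^{⊗ k} → W`, indexed by the arity `k`, i.e. a linear map
`⨁ₖ V^{⊗ k} → W`.  Maps on the *reduced* tensor module are the families with `f 0 = 0`;
this is part of `homDeg` below. -/
abbrev TensorHom (K V W : Type*) [Field K] [AddCommGroup V] [Module K V]
    [AddCommGroup W] [Module K W] : Type _ :=
  ∀ k : ℕ, MultilinearMap K (fun _ : Fin k => V) W

/-- `Hom_n (T̄(V), W)`: families of multilinear maps of degree `n`, of arities `k ≥ 1`. -/
def homDeg {K V W : Type*} [Field K] [AddCommGroup V] [Module K V] [AddCommGroup W] [Module K W]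
    (𝒱 : ℤ → Submodule K V) (𝒲 : ℤ → Submodule K W) (n : ℤ) : Submodule K (TensorHom K V W) where
  carrier := {f | f 0 = 0 ∧ ∀ (k : ℕ) (d : Fin k → ℤ) (v : Fin k → V),
    (∀ r, v r ∈ 𝒱 (d r)) → f k v ∈ 𝒲 (n + ∑ r, d r)}
  add_mem' := by
    rintro f g ⟨hf, hf'⟩ ⟨hg, hg'⟩
    exact ⟨by simp [hf, hg], fun k d v hv => (𝒲 _).add_mem (hf' k d v hv) (hg' k d v hv)⟩
  zero_mem' := ⟨rfl, fun _ _ _ _ => (𝒲 _).zero_mem⟩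
  smul_mem' := by
    rintro c f ⟨hf, hf'⟩
    exact ⟨by simp [hf], fun k d v hv => (𝒲 _).smul_mem c (hf' k d v hv)⟩

/-- The ways of cutting `N` consecutive letters into a left part of `i`, a middle part of `l`
and a right part of `t` letters. -/
abbrev Cut (N : ℕ) : Type :=
  {x : Fin (N + 1) × Fin (N + 1) × Fin (N + 1) // (x.1 : ℕ) + x.2.1 + x.2.2 = N}

namespace Cut

/-- Length of the left part. -/
abbrev left {N : ℕ} (x : Cut N) : ℕ := x.1.1
/-- Length of the middle part. -/
abbrev mid {N : ℕ} (x : Cut N) : ℕ := x.1.2.1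
/-- Length of the right part. -/
abbrev right {N : ℕ} (x : Cut N) : ℕ := x.1.2.2

theorem sum_eq {N : ℕ} (x : Cut N) : x.left + x.mid + x.right = N := x.2

/-- The middle part `(a_{i+1}, …, a_{i+l})` of the word `(a_1, …, a_N)`. -/
def block {N : ℕ} {X : Type*} (x : Cut N) (a : Fin N → X) : Fin x.mid → X :=
  fun r => a ⟨x.left + r, by have := x.sum_eq; have := r.2; omega⟩

/-- The word `(a_1, …, a_i, y, a_{i+l+1}, …, a_N)`: the middle part is replaced by `y`. -/
def splice {N : ℕ} {X : Type*} (x : Cut N) (a : Fin N → X) (y : X) :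
    Fin (x.left + 1 + x.right) → X :=
  fun r =>
    if _h : (r : ℕ) < x.left then a ⟨r, by have := x.sum_eq; omega⟩
    else if _h' : (r : ℕ) = x.left then y
    else a ⟨r - 1 + x.mid, by have := x.sum_eq; have := r.2; omega⟩

/-- The sum of the degrees of the letters of the left part. -/
def leftDeg {N : ℕ} (x : Cut N) (d : Fin N → ℤ) : ℤ :=
  ∑ r : Fin N, if (r : ℕ) < x.left then d r else 0

theorem splice_eq_update {N : ℕ} {X : Type*} (x : Cut N) (a : Fin N → X) (y z : X) :
    x.splice a y = Function.update (x.splice a z) ⟨x.left, by omega⟩ y := by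
  funext r
  simp only [splice, Function.update_apply, Fin.ext_iff]
  split_ifs <;> first | rfl | omega

/-- How changing one letter of a word acts on its middle part and on the spliced word. -/
theorem update_cases {N : ℕ} (X : Type*) (x : Cut N) (s : Fin N) :
    ((s : ℕ) < x.left ∧ ∃ q, (∀ (a : Fin N → X) v,
        x.block (Function.update a s v) = x.block a) ∧
      ∀ (a : Fin N → X) v y,
        x.splice (Function.update a s v) y = Function.update (x.splice a y) q v) ∨
    (x.left ≤ (s : ℕ) ∧ ∃ q, (∀ (a : Fin N → X) v,
        x.block (Function.update a s v) = Function.update (x.block a) q v) ∧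
      ∀ (a : Fin N → X) v y, x.splice (Function.update a s v) y = x.splice a y) ∨
    (x.left ≤ (s : ℕ) ∧ ∃ q, (∀ (a : Fin N → X) v,
        x.block (Function.update a s v) = x.block a) ∧
      ∀ (a : Fin N → X) v y,
        x.splice (Function.update a s v) y = Function.update (x.splice a y) q v) := by
  have hx := x.sum_eq
  have hsN := s.2
  by_cases h1 : (s : ℕ) < x.left
  · refine Or.inl ⟨h1, ⟨s, by omega⟩, fun a v => ?_, fun a v y => ?_⟩ <;> funext r <;>
      have hr := r.2 <;>
      simp only [block, splice, Function.update_apply, Fin.ext_iff] <;>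
      split_ifs <;> first | rfl | omega
  by_cases h2 : (s : ℕ) < x.left + x.mid
  · refine Or.inr (Or.inl ⟨by omega, ⟨s - x.left, by omega⟩, fun a v => ?_, fun a v y => ?_⟩) <;>
      funext r <;> have hr := r.2 <;>
      simp only [block, splice, Function.update_apply, Fin.ext_iff] <;>
      split_ifs <;> first | rfl | omega
  · refine Or.inr (Or.inr ⟨by omega, ⟨s + 1 - x.mid, by omega⟩, fun a v => ?_,
        fun a v y => ?_⟩) <;>
      funext r <;> have hr := r.2 <;>
      simp only [block, splice, Function.update_apply, Fin.ext_iff] <;>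
      split_ifs <;> first | rfl | omega

theorem signed_update_lt {N i : ℕ} {X : Type*} (σ : X → X) {s : Fin N} (hs : (s : ℕ) < i)
    (a : Fin N → X) (v : X) :
    (fun r : Fin N => if (r : ℕ) < i then σ (Function.update a s v r)
      else Function.update a s v r) =
    Function.update (fun r : Fin N => if (r : ℕ) < i then σ (a r) else a r) s (σ v) := by
  funext r
  by_cases h : r = s
  · subst h; simp [hs]
  · simp [h]

theorem signed_update_ge {N i : ℕ} {X : Type*} (σ : X → X) {s : Fin N} (hs : i ≤ (s : ℕ))
    (a : Fin N → X) (v : X) :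
    (fun r : Fin N => if (r : ℕ) < i then σ (Function.update a s v r)
      else Function.update a s v r) =
    Function.update (fun r : Fin N => if (r : ℕ) < i then σ (a r) else a r) s v := by
  funext r
  by_cases h : r = s
  · subst h; simp [hs]
  · simp [h]

end Cut

section Gerstenhaber

variable {K V : Type*} [Field K] [AddCommGroup V] [Module K V]

/-- The operator acting on `V_i` as `(-1)^{n i}`: the Koszul sign for moving an operation of
degree `n` past an element of `V`. -/
noncomputable def koszulSign (𝒱 : ℤ → Submodule K V) [DirectSum.Decomposition 𝒱] (n : ℤ) :
    V →ₗ[K] V :=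
  (DirectSum.toModule K ℤ V fun i => ((-1 : K) ^ (n * i)) • (𝒱 i).subtype) ∘ₗ
    (DirectSum.decomposeLinearEquiv 𝒱).toLinearMap

/-- One summand of the circle product:
`(-1)^{n(|a_1| + ⋯ + |a_i|)} f (a_1, …, a_i, g (a_{i+1}, …, a_{i+l}), a_{i+l+1}, …, a_N)`. -/
noncomputable def circAt (𝒱 : ℤ → Submodule K V) [DirectSum.Decomposition 𝒱] (n : ℤ)
    {N : ℕ} (x : Cut N)
    (f : MultilinearMap K (fun _ : Fin (x.left + 1 + x.right) => V) V)
    (g : MultilinearMap K (fun _ : Fin x.mid => V) V) :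
    MultilinearMap K (fun _ : Fin N => V) V where
  toFun a := f (x.splice
    (fun r => if (r : ℕ) < x.left then koszulSign 𝒱 n (a r) else a r) (g (x.block a)))
  map_update_add' := by
    intro _ a s v w
    obtain rfl : ‹DecidableEq (Fin N)› = instDecidableEqFin N := Subsingleton.elim _ _
    rcases x.update_cases V s with ⟨hs, q, hb, hq⟩ | ⟨hs, q, hb, hq⟩ | ⟨hs, q, hb, hq⟩
    · simp only [Cut.signed_update_lt _ hs, hb, hq, map_add, MultilinearMap.map_update_add]
    · simp only [Cut.signed_update_ge _ hs, hb, hq, MultilinearMap.map_update_add]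
      rw [x.splice_eq_update _ (_ + _) 0, MultilinearMap.map_update_add,
        ← x.splice_eq_update, ← x.splice_eq_update]
    · simp only [Cut.signed_update_ge _ hs, hb, hq, MultilinearMap.map_update_add]
  map_update_smul' := by
    intro _ a s c v
    obtain rfl : ‹DecidableEq (Fin N)› = instDecidableEqFin N := Subsingleton.elim _ _
    rcases x.update_cases V s with ⟨hs, q, hb, hq⟩ | ⟨hs, q, hb, hq⟩ | ⟨hs, q, hb, hq⟩
    · simp only [Cut.signed_update_lt _ hs, hb, hq, map_smul, MultilinearMap.map_update_smul]
    · simp only [Cut.signed_update_ge _ hs, hb, hq, MultilinearMap.map_update_smul]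
      rw [x.splice_eq_update _ (_ • _) 0, MultilinearMap.map_update_smul, ← x.splice_eq_update]
    · simp only [Cut.signed_update_ge _ hs, hb, hq, MultilinearMap.map_update_smul]

/-- The circle product `f ∘ g`, for `g` of degree `n`. -/
noncomputable def circ (𝒱 : ℤ → Submodule K V) [DirectSum.Decomposition 𝒱] (n : ℤ)
    (f g : TensorHom K V V) : TensorHom K V V :=
  fun N => ∑ x : Cut N, circAt 𝒱 n x (f (x.left + 1 + x.right)) (g x.mid)

/-- The graded Lie bracket `[f, g] = f ∘ g - (-1)^{mn} g ∘ f` on `⨁ₙ Hom_n (T̄(V), V)`, for `f` of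
degree `m` and `g` of degree `n`. -/
noncomputable def gBracket (𝒱 : ℤ → Submodule K V) [DirectSum.Decomposition 𝒱] (m n : ℤ)
    (f g : TensorHom K V V) : TensorHom K V V :=
  circ 𝒱 n f g - ((-1 : K) ^ (m * n)) • circ 𝒱 m g f

end Gerstenhaber

section RotaBaxter

variable {K A M : Type*} [Field K] [AddCommGroup A] [Module K A] [AddCommGroup M] [Module K M]

/-- The grading of `A ⊕ M`. -/
def prodGrading (𝒜 : ℤ → Submodule K A) (ℳ : ℤ → Submodule K M) : ℤ → Submodule K (A × M) :=
  fun i => (𝒜 i).prod (ℳ i)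

/-- The inclusion `A_i → (A ⊕ M)_i`. -/
def prodGrading.inl (𝒜 : ℤ → Submodule K A) (ℳ : ℤ → Submodule K M) (i : ℤ) :
    𝒜 i →ₗ[K] prodGrading 𝒜 ℳ i :=
  (LinearMap.inl K A M ∘ₗ (𝒜 i).subtype).codRestrict (prodGrading 𝒜 ℳ i)
    fun a => ⟨a.2, (ℳ i).zero_mem⟩

/-- The inclusion `M_i → (A ⊕ M)_i`. -/
def prodGrading.inr (𝒜 : ℤ → Submodule K A) (ℳ : ℤ → Submodule K M) (i : ℤ) :
    ℳ i →ₗ[K] prodGrading 𝒜 ℳ i :=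
  (LinearMap.inr K A M ∘ₗ (ℳ i).subtype).codRestrict (prodGrading 𝒜 ℳ i)
    fun m => ⟨(𝒜 i).zero_mem, m.2⟩

theorem prodGrading.coe_inl (𝒜 : ℤ → Submodule K A) (ℳ : ℤ → Submodule K M) (i : ℤ) (a : 𝒜 i) :
    (prodGrading.inl 𝒜 ℳ i a : A × M) = ((a : A), 0) := rfl

theorem prodGrading.coe_inr (𝒜 : ℤ → Submodule K A) (ℳ : ℤ → Submodule K M) (i : ℤ) (m : ℳ i) :
    (prodGrading.inr 𝒜 ℳ i m : A × M) = (0, (m : M)) := rfl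

noncomputable instance prodGrading.decomposition (𝒜 : ℤ → Submodule K A) (ℳ : ℤ → Submodule K M)
    [DirectSum.Decomposition 𝒜] [DirectSum.Decomposition ℳ] :
    DirectSum.Decomposition (prodGrading 𝒜 ℳ) :=
  DirectSum.Decomposition.ofLinearMap (prodGrading 𝒜 ℳ)
    (DirectSum.lmap (prodGrading.inl 𝒜 ℳ) ∘ₗ
        (DirectSum.decomposeLinearEquiv 𝒜).toLinearMap ∘ₗ LinearMap.fst K A M +
      DirectSum.lmap (prodGrading.inr 𝒜 ℳ) ∘ₗ
        (DirectSum.decomposeLinearEquiv ℳ).toLinearMap ∘ₗ LinearMap.snd K A M)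
    (by
      have h1 : DirectSum.coeLinearMap (prodGrading 𝒜 ℳ) ∘ₗ
          DirectSum.lmap (prodGrading.inl 𝒜 ℳ) =
          LinearMap.inl K A M ∘ₗ DirectSum.coeLinearMap 𝒜 := by
        ext <;> simp [prodGrading.coe_inl]
      have h2 : DirectSum.coeLinearMap (prodGrading 𝒜 ℳ) ∘ₗ
          DirectSum.lmap (prodGrading.inr 𝒜 ℳ) =
          LinearMap.inr K A M ∘ₗ DirectSum.coeLinearMap ℳ := by
        ext <;> simp [prodGrading.coe_inr]
      have h3 := fun a => (DirectSum.decomposeLinearEquiv 𝒜).symm_apply_apply a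
      have h4 := fun m => (DirectSum.decomposeLinearEquiv ℳ).symm_apply_apply m
      refine LinearMap.ext fun v => ?_
      obtain ⟨a, m⟩ := v
      refine (map_add (DirectSum.coeLinearMap (prodGrading 𝒜 ℳ)) _ _).trans
        ((congrArg₂ (· + ·)
          ((DFunLike.congr_fun h1 _).trans (congrArg (LinearMap.inl K A M) (h3 a)))
          ((DFunLike.congr_fun h2 _).trans (congrArg (LinearMap.inr K A M) (h4 m)))).trans ?_)
      simp)
    (by
      refine DirectSum.linearMap_ext K fun i => LinearMap.ext fun v => ?_
      obtain ⟨⟨a, m⟩, ha, hm⟩ := v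
      have h3 := DirectSum.decomposeLinearEquiv_apply_coe (R := K) 𝒜 i ⟨a, ha⟩
      have h4 := DirectSum.decomposeLinearEquiv_apply_coe (R := K) ℳ i ⟨m, hm⟩
      simp only [] at h3 h4
      simp only [LinearMap.comp_apply, LinearMap.add_apply, DirectSum.coeLinearMap_lof,
        LinearMap.fst_apply, LinearMap.snd_apply, LinearEquiv.coe_coe, h3, h4,
        DirectSum.lmap_lof, ← map_add, LinearMap.id_apply]
      congr 1
      ext <;> simp [prodGrading.coe_inl, prodGrading.coe_inr])

/-- `A_∞[1]`-algebras: degree `1` maps `μ_k : A^{⊗ k} → A`, `k ≥ 1`, with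
`∑ (-1)^{|a_1| + ⋯ + |a_i|} μ (a_1, …, a_i, μ (a_{i+1}, …, a_{i+l}), a_{i+l+1}, …, a_n) = 0`. -/
structure IsAInfinityOneAlgebra (𝒜 : ℤ → Submodule K A) (μ : TensorHom K A A) : Prop where
  degree_one : μ ∈ homDeg 𝒜 𝒜 1
  relation : ∀ n : ℕ, 1 ≤ n → ∀ (d : Fin n → ℤ) (a : Fin n → A), (∀ r, a r ∈ 𝒜 (d r)) →
    ∑ x : Cut n, ((-1 : K) ^ x.leftDeg d) •
      μ (x.left + 1 + x.right) (x.splice a (μ x.mid (x.block a))) = 0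

/-- Bimodules over an `A_∞[1]`-algebra.  A family of maps `η_k : 𝒜^{k-1,1} → M` (exactly one
argument in `M`, all others in `A`) is encoded by its horizontal lift to `(A ⊕ M)^{⊗ k}`, which is
zero on the other summands of `(A ⊕ M)^{⊗ k}`. -/
structure IsAInfinityOneBimodule (𝒜 : ℤ → Submodule K A) (ℳ : ℤ → Submodule K M)
    (μ : TensorHom K A A) (η : TensorHom K (A × M) M) : Prop where
  degree_one : η ∈ homDeg (prodGrading 𝒜 ℳ) ℳ 1
  horizontal : ∀ (k : ℕ) (S : Finset (Fin k)) (v : Fin k → A × M),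
    (∀ r ∈ S, (v r).1 = 0) → (∀ r ∉ S, (v r).2 = 0) → S.card ≠ 1 → η k v = 0
  /-- The `A_∞[1]`-relations with the `s`-th argument `m` from `M` and all others from `A`. -/
  relation : ∀ n : ℕ, 1 ≤ n → ∀ (s : Fin n) (d : Fin n → ℤ) (a : Fin n → A) (m : M),
    (∀ r, r ≠ s → a r ∈ 𝒜 (d r)) → m ∈ ℳ (d s) →
    let v : Fin n → A × M := fun r => if r = s then (0, m) else (a r, 0)
    ∑ x : Cut n, ((-1 : K) ^ x.leftDeg d) •
      η (x.left + 1 + x.right) (x.splice v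
        (if x.left ≤ (s : ℕ) ∧ (s : ℕ) < x.left + x.mid then (0, η x.mid (x.block v))
          else (μ x.mid (x.block a), 0))) = 0

/-- The element `△ = ∑ₖ (μ_k + η_k)` of `Hom_1 (T̄(A ⊕ M), A ⊕ M)`. -/
def structureElement (μ : TensorHom K A A) (η : TensorHom K (A × M) M) :
    TensorHom K (A × M) (A × M) :=
  fun k => (LinearMap.inl K A M).compMultilinearMap
      ((μ k).compLinearMap fun _ => LinearMap.fst K A M) +
    (LinearMap.inr K A M).compMultilinearMap (η k)

/-- The inclusion of `𝔞 = ⨁ₙ Hom_n (T̄(M), A)` into `L = ⨁ₙ Hom_n (T̄(A ⊕ M), A ⊕ M)`. -/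
def inclA (T : TensorHom K M A) : TensorHom K (A × M) (A × M) :=
  fun k => (LinearMap.inl K A M).compMultilinearMap
    ((T k).compLinearMap fun _ => LinearMap.snd K A M)

/-- The projection `P : L → 𝔞`. -/
def projA (f : TensorHom K (A × M) (A × M)) : TensorHom K M A :=
  fun k => (LinearMap.fst K A M).compMultilinearMap
    ((f k).compLinearMap fun _ => LinearMap.inr K A M)

/-- `[⋯[[f, a_1], a_2], ⋯, a_k]` for `f ∈ L` of degree `m` and a list of `a_i ∈ 𝔞`, each given with
its degree. -/
noncomputable def nestedBracket (𝒜 : ℤ → Submodule K A) (ℳ : ℤ → Submodule K M)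
    [DirectSum.Decomposition 𝒜] [DirectSum.Decomposition ℳ] :
    ℤ → TensorHom K (A × M) (A × M) → List (ℤ × TensorHom K M A) → TensorHom K (A × M) (A × M)
  | _, f, [] => f
  | m, f, (d, a) :: as =>
      nestedBracket 𝒜 ℳ (m + d) (gBracket (prodGrading 𝒜 ℳ) m d f (inclA a)) as

/-- The derived brackets `l_k (a_1, …, a_k) = P [⋯[[△, a_1], a_2], ⋯, a_k]`: the structure maps of
the `L_∞[1]`-algebra on `𝔞`.  The homogeneous arguments are given as a list of length `k`, each
with its degree. -/
noncomputable def derivedBracket (𝒜 : ℤ → Submodule K A) (ℳ : ℤ → Submodule K M)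
    [DirectSum.Decomposition 𝒜] [DirectSum.Decomposition ℳ]
    (μ : TensorHom K A A) (η : TensorHom K (A × M) M) (as : List (ℤ × TensorHom K M A)) :
    TensorHom K M A :=
  projA (nestedBracket 𝒜 ℳ 1 (structureElement μ η) as)

/-- The filtration `ℱ_n 𝔞`: families whose components of arity `< n` vanish. -/
def arityFiltration (K A M : Type*) [Field K] [AddCommGroup A] [Module K A] [AddCommGroup M]
    [Module K M] (n : ℕ) : Submodule K (TensorHom K M A) where
  carrier := {f | ∀ k < n, f k = 0}
  add_mem' := fun {f g} hf hg k hk => by simp [hf k hk, hg k hk]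
  zero_mem' := fun _ _ => rfl
  smul_mem' := fun c f hf k hk => by simp [hf k hk]

/-- Homotopy relative Rota-Baxter operators: degree `0` elements `T` of `𝔞` with
`∑_{k ≥ 1} (1/k!) l_k (T, …, T) = 0`, where the infinite sum is taken in the topology of the
complete filtration `ℱ`. -/
def IsHomotopyRelRotaBaxter (𝒜 : ℤ → Submodule K A) (ℳ : ℤ → Submodule K M)
    [DirectSum.Decomposition 𝒜] [DirectSum.Decomposition ℳ]
    (μ : TensorHom K A A) (η : TensorHom K (A × M) M) (T : TensorHom K M A) : Prop :=
  T ∈ homDeg ℳ 𝒜 0 ∧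
    ∀ n : ℕ, ∀ᶠ N : ℕ in atTop,
      ∑ k ∈ Finset.Icc 1 N, ((k.factorial : K)⁻¹) •
        derivedBracket 𝒜 ℳ μ η (List.replicate k (0, T)) ∈ arityFiltration K A M n

/-- `∑ μ_n (T_{k_1} (u_1, …, u_{k_1}), …, T_{k_n} (…, u_p))` over all `n` and all
`k_1 + ⋯ + k_n = p` with `k_i ≥ 1`. -/
def rotaBaxterLHS (μ : TensorHom K A A) (T : TensorHom K M A) (p : ℕ) (u : Fin p → M) : A :=
  ∑ c : Composition p, μ c.length fun r => T (c.blocksFun r) (u ∘ c.embedding r)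

/-- The sum of all
`(-1)^{|u_1| + ⋯ + |u_j|} T_{j+1+t} (u_1, …, u_j, η_n (T_{k_1} (…), …, T_{k_{i-1}} (…), u,
T_{k_{i+1}} (…), …, T_{k_n} (…)), u_{p-t+1}, …, u_p)`
over all `n ≥ 1`, `1 ≤ i ≤ n` and `j + (k_1 + ⋯ + k_{i-1} + 1 + k_{i+1} + ⋯ + k_n) + t = p`:
here `k` is a composition of the length of the middle part of `u`, with `k_i = 1`. -/
def rotaBaxterRHS (η : TensorHom K (A × M) M) (T : TensorHom K M A) (p : ℕ) (d : Fin p → ℤ)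
    (u : Fin p → M) : A :=
  ∑ x : Cut p, ∑ c : Composition x.mid, ∑ i : Fin c.length,
    if c.blocksFun i = 1 then
      ((-1 : K) ^ x.leftDeg d) • T (x.left + 1 + x.right) (x.splice u
        (η c.length fun r =>
          if r = i then (0, x.block u (c.embedding i ⟨0, c.one_le_blocksFun i⟩))
          else (T (c.blocksFun r) (x.block u ∘ c.embedding r), 0)))
    else 0

end RotaBaxter

/-! Let `θ` be $T$ extended by zero to $A\oplus M$ (`inclA T`). It takes values in $A$ and vanishes
as soon as one argument lies in $A$, so every term in which one `θ` is fed directly into another is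
zero. Expanding $[\cdots[\triangle,θ],\dots,θ]$ with $k+1$ brackets therefore leaves two kinds of
terms: $\triangle$ with `θ` inserted in $k+1$ disjoint places, minus `θ` applied to $\triangle$ with
$k$ insertions. Both occur $(k+1)!$ times (`iterate_commutator`), which cancels the coefficient in
the Maurer–Cartan equation.

Now evaluate on a word in $M$ and project to $A$. In the first term the $A$-component of $\triangle$
is $\mu$, which vanishes on any remaining letter of $M$; the inserted blocks must cover the word,
and the sum over $k$ is the sum over all compositions, i.e. the left side (`sum_insertMany_fst`). In
the second term the outer `θ` reads only the $M$-component, which is $\eta$ with exactly one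
argument in $M$; one block of length one stays bare and all others are replaced, which gives the
right side (`sum_insertMany_snd`). Its sign is the Koszul sign of moving the degree $1$ inner
operation past the letters on its left.

A word of length $p$ has at most $p$ disjoint nonempty factors, so in arity $p$ the partial sums are
constant from $N=p$ on (`sum_derivedBracket_eq`). Multilinearity reduces vanishing to homogeneous
words.

The combinatorics is done on lists, where insertions obey recursions in the head letter.
`evalList_circ` translates the circle product into insertions, and `insertMany_map_list` translates
insertions into compositions. -/

/-! ### Splitting words and inserting operations into them. -/

section Words

variable {U V W W' : Type*} [AddCommGroup W] [AddCommGroup W']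

/-- The sum of `Q b c` over all ways of writing a word as a concatenation `b ++ c`. -/
def splitSum : List V → (List V → List V → W) → W
  | [], Q => Q [] []
  | x :: l, Q => Q [] (x :: l) + splitSum l fun b c => Q (x :: b) c

theorem splitSum_congr {l : List V} {Q Q' : List V → List V → W}
    (h : ∀ b c, b ++ c = l → Q b c = Q' b c) : splitSum l Q = splitSum l Q' := by
  induction l generalizing Q Q' with
  | nil => exact h [] [] rfl
  | cons x l ih =>
    simp only [splitSum]
    rw [h [] (x :: l) rfl, ih fun b c hbc => h (x :: b) c (by simp [hbc])]

theorem splitSum_zero (l : List V) : splitSum l (fun _ _ => (0 : W)) = 0 := by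
  induction l with
  | nil => rfl
  | cons x l ih => simp [splitSum, ih]

theorem splitSum_add (l : List V) (Q Q' : List V → List V → W) :
    splitSum l (fun b c => Q b c + Q' b c) = splitSum l Q + splitSum l Q' := by
  induction l generalizing Q Q' with
  | nil => rfl
  | cons x l ih => simp only [splitSum, ih]; abel

theorem splitSum_map (φ : W →+ W') (l : List V) (Q : List V → List V → W) :
    splitSum l (fun b c => φ (Q b c)) = φ (splitSum l Q) := by
  induction l generalizing Q with
  | nil => rfl
  | cons x l ih => simp only [splitSum, ih, map_add]

theorem splitSum_nsmul (n : ℕ) (l : List V) (Q : List V → List V → W) :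
    splitSum l (fun b c => n • Q b c) = n • splitSum l Q :=
  splitSum_map (nsmulAddMonoidHom n) l Q

/-- Coassociativity of deconcatenation: both sides run over the factorizations into three parts. -/
theorem splitSum_assoc (l : List V) (Q : List V → List V → List V → W) :
    splitSum l (fun b c => splitSum b fun b₁ b₂ => Q b₁ b₂ c) =
      splitSum l fun b c => splitSum c fun c₁ c₂ => Q b c₁ c₂ := by
  induction l generalizing Q with
  | nil => rfl
  | cons x l ih => simp only [splitSum, splitSum_add, ih]; abel

theorem splitSum_map_list (ι : U → V) (l : List U) (Q : List V → List V → W) :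
    splitSum (l.map ι) Q = splitSum l fun b c => Q (b.map ι) (c.map ι) := by
  induction l generalizing Q with
  | nil => rfl
  | cons x l ih => simp only [splitSum, List.map_cons, List.map_nil, ih]

theorem splitSum_eq_sum_antidiagonal (l : List V) (Q : List V → List V → W) :
    splitSum l Q =
      ∑ ab ∈ Finset.HasAntidiagonal.antidiagonal l.length, Q (l.take ab.1) (l.drop ab.1) := by
  induction l generalizing Q with
  | nil => simp [splitSum]
  | cons x l ih => simp [splitSum, ih, Finset.Nat.sum_antidiagonal_succ]

theorem splitSum_eq_of_left_nil (l : List V) (Q : List V → List V → W)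
    (h : ∀ x b c, Q (x :: b) c = 0) : splitSum l Q = Q [] l := by
  cases l with
  | nil => rfl
  | cons x l => simp [splitSum, h, splitSum_zero]

/-- The function `F` on words vanishes as soon as some letter lies in `Z`. -/
def Kills (Z : Set V) (F : List V → W) : Prop :=
  ∀ l, ∀ z ∈ l, z ∈ Z → F l = 0

theorem Kills.cons {Z : Set V} {F : List V → W} (h : Kills Z F) (x : V) :
    Kills Z fun m => F (x :: m) :=
  fun l z hz hZ => h (x :: l) z (List.mem_cons_of_mem x hz) hZ

theorem Kills.eq_zero {Z : Set V} {F : List V → W} (h : Kills Z F) {z : V} (hz : z ∈ Z) :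
    (fun m => F (z :: m)) = 0 :=
  funext fun m => h (z :: m) z List.mem_cons_self hz

/-- The sum over all factorizations `a ++ b ++ c` of a word, with `b` nonempty, of the
value at `c` of `H` applied to the function `m ↦ F (σ a ++ f b :: m)`. -/
def insertSum (σ : V → V) (f : List V → V) (H : (List V → W) → List V → W) :
    (List V → W) → List V → W
  | _, [] => 0
  | F, x :: l => insertSum σ f H (fun m => F (σ x :: m)) l +
      splitSum l fun b c => H (fun m => F (f (x :: b) :: m)) c

/-- The sum of all `F (a ++ f b :: c)` over the factorizations `a ++ b ++ c` of a word, with `b`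
nonempty. -/
abbrev insertOne (f : List V → V) : (List V → W) → List V → W := insertSum id f id

/-- The sum over all ways of replacing `k` disjoint nonempty factors `b` of a word by `f b`. -/
def insertMany (f : List V → V) : ℕ → (List V → W) → List V → W
  | 0 => id
  | k + 1 => insertSum id f (insertMany f k)

theorem insertSum_zero (σ : V → V) (f : List V → V) (H : (List V → W) → List V → W)
    (hH : H 0 = 0) : insertSum σ f H 0 = 0 := by
  funext l
  induction l with
  | nil => rfl
  | cons x l ih =>
    have h0 : (fun _ : List V => (0 : W)) = 0 := rfl
    simp only [insertSum, Pi.zero_apply, h0, ih, hH, splitSum_zero, add_zero]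

theorem insertMany_zero (f : List V → V) (k : ℕ) : insertMany f k (0 : List V → W) = 0 := by
  induction k with
  | zero => rfl
  | succ k ih => exact insertSum_zero _ _ _ ih

theorem insertSum_id_add (σ : V → V) (f : List V → V) (F G : List V → W) (l : List V) :
    insertSum σ f id (fun m => F m + G m) l =
      insertSum σ f id F l + insertSum σ f id G l := by
  induction l generalizing F G with
  | nil => simp [insertSum]
  | cons x l ih => simp only [insertSum, ih, id, splitSum_add]; abel

theorem insertSum_id_map (σ : V → V) (f : List V → V) (φ : W →+ W') (F : List V → W)
    (l : List V) : insertSum σ f id (fun m => φ (F m)) l = φ (insertSum σ f id F l) := by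
  induction l generalizing F with
  | nil => simp [insertSum]
  | cons x l ih => simp only [insertSum, ih, id, splitSum_map, map_add]

theorem insertMany_map (f : List V → V) (φ : W →+ W') (k : ℕ) (F : List V → W) (l : List V) :
    insertMany f k (fun m => φ (F m)) l = φ (insertMany f k F l) := by
  induction k generalizing F l with
  | zero => rfl
  | succ k ihk =>
    simp only [insertMany]
    induction l generalizing F with
    | nil => simp [insertSum]
    | cons x l ih => simp only [insertSum, ih, ihk, splitSum_map, map_add]

/-- Every summand is `G` at a word containing a value of `f`. This is the form in which `θ` fed into
`θ` disappears. -/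
theorem insertSum_eq_zero_of_kills {Z : Set V} (σ : V → V) {f : List V → V} (hf : ∀ l, f l ∈ Z)
    {G : List V → W} (hG : Kills Z G) (l : List V) : insertSum σ f id G l = 0 := by
  induction l generalizing G with
  | nil => rfl
  | cons x l ih =>
    simp only [insertSum, id]
    rw [ih (hG.cons _), zero_add, ← splitSum_zero (W := W) l]
    exact splitSum_congr fun b c _ => hG _ _ List.mem_cons_self (hf _)

theorem insertSum_mem {Z : AddSubgroup W} (σ : V → V) (f : List V → V) {G : List V → W}
    (hG : ∀ l, G l ∈ Z) (l : List V) : insertSum σ f id G l ∈ Z := by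
  induction l generalizing G with
  | nil => exact Z.zero_mem
  | cons x l ih =>
    refine Z.add_mem (ih fun l => hG _) ?_
    rw [splitSum_eq_sum_antidiagonal]
    exact Z.sum_mem fun _ _ => hG _

/-- Inserting `f` into a word before splitting it amounts to inserting it into the left or into
the right part, or across. -/
theorem insertOne_splitSum (f : List V → V) (Q : List V → List V → W) (l : List V) :
    insertOne f (fun m => splitSum m Q) l =
      splitSum l (fun b c => insertOne f (fun m => Q m c) b) +
        splitSum l fun b c => insertOne f (Q b) c := by
  induction l generalizing Q with
  | nil => simp [insertOne, insertSum, splitSum]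
  | cons x l ih =>
    have ih' := ih fun b c => Q (x :: b) c
    simp only [insertOne] at ih' ⊢
    simp only [insertSum, splitSum, id, insertSum_id_add, splitSum_add] at ih' ⊢
    rw [ih', splitSum_assoc l fun b₁ b₂ c => Q (f (x :: b₁) :: b₂) c]
    abel

end Words

/-! ### Repeated insertion and the iterated commutator. -/

section WordsAdd

variable {U V W W' : Type*} [AddCommGroup V] [AddCommGroup W] [AddCommGroup W']

/-- Inserting `f` into `k` places and then into one more gives each choice of `k + 1` places
`k + 1` times, provided that `f` vanishes on words that contain a value of `f`. -/
theorem insertOne_insertMany {Z : Set V} {f : List V → V} (hZ : ∀ l, f l ∈ Z)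
    (hf : Kills Z f) (k : ℕ) {F : List V → W} (hF : Kills {0} F) (l : List V) :
    insertOne f (insertMany f k F) l = (k + 1) • insertMany f (k + 1) F l := by
  induction k generalizing F l with
  | zero => simp [insertMany]
  | succ k ihk =>
    induction l generalizing F with
    | nil => simp [insertMany, insertOne, insertSum]
    | cons x l ihl =>
      -- The head letter either stays or starts the leftmost replaced factor.
      have e : ∀ (y : V) (F : List V → W), (fun m => insertMany f (k + 1) F (y :: m)) =
          fun m => insertMany f (k + 1) (fun m => F (y :: m)) m +
            splitSum m fun b c => insertMany f k (fun m => F (f (y :: b) :: m)) c :=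
        fun _ _ => rfl
      have e' : insertMany f (k + 1 + 1) F (x :: l) =
          insertMany f (k + 1 + 1) (fun m => F (x :: m)) l +
            splitSum l fun b c => insertMany f (k + 1) (fun m => F (f (x :: b) :: m)) c := rfl
      have h1 := ihl (hF.cons x)
      have h2 := insertOne_splitSum f
        (fun b c => insertMany f k (fun m => F (f (x :: b) :: m)) c) l
      -- An insertion inside a factor that is itself replaced would put a value of `f` under `f`.
      have h3 : ∀ c, insertOne f (fun b => insertMany f k (fun m => F (f (x :: b) :: m)) c) =
          0 := by
        intro c
        funext l
        refine insertSum_eq_zero_of_kills id hZ (Z := Z) ?_ l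
        intro b z hz hzZ
        have : f (x :: b) = 0 := hf _ z (List.mem_cons_of_mem x hz) hzZ
        simp only [this, hF.eq_zero rfl, insertMany_zero, Pi.zero_apply]
      -- A head letter that is already a value of `f` cannot belong to a replaced factor.
      have h4 : ∀ b c, insertMany f (k + 1) F (f (x :: b) :: c) =
          insertMany f (k + 1) (fun m => F (f (x :: b) :: m)) c := by
        intro b c
        have := congrFun (e (f (x :: b)) F) c
        rw [this, add_eq_left, ← splitSum_zero (W := W) c]
        refine splitSum_congr fun b' c' _ => ?_
        have : f (f (x :: b) :: b') = 0 := hf _ _ List.mem_cons_self (hZ _)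
        simp only [this, hF.eq_zero rfl, insertMany_zero, Pi.zero_apply]
      have h5 : insertOne f (insertMany f (k + 1) F) (x :: l) =
          insertOne f (fun m => insertMany f (k + 1) F (x :: m)) l +
            splitSum l fun b c => insertMany f (k + 1) F (f (x :: b) :: c) := rfl
      have h6 : ∀ b c, insertOne f (insertMany f k fun m => F (f (x :: b) :: m)) c =
          (k + 1) • insertMany f (k + 1) (fun m => F (f (x :: b) :: m)) c :=
        fun b c => ihk (hF.cons _) c
      have h7 : insertOne f (fun m => insertMany f (k + 1) F (x :: m)) l =
          insertOne f (insertMany f (k + 1) fun m => F (x :: m)) l +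
          insertOne f (fun m => splitSum m fun b c =>
            insertMany f k (fun m => F (f (x :: b) :: m)) c) l := by
        rw [e]
        exact insertSum_id_add _ _ _ _ _
      rw [h5, h7, h1, h2, e']
      simp only [h3, h4, Pi.zero_apply, splitSum_zero, zero_add]
      have h8 : splitSum l (fun b c => insertOne f
          (fun c => insertMany f k (fun m => F (f (x :: b) :: m)) c) c) =
          (k + 1) • splitSum l fun b c =>
            insertMany f (k + 1) (fun m => F (f (x :: b) :: m)) c := by
        rw [← splitSum_nsmul]
        exact splitSum_congr fun b c _ => h6 b c
      rw [h8, smul_add, succ_nsmul (splitSum _ _) (k + 1)]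
      abel

/-- The function `F` on words is additive in each letter. -/
def AdditiveWords (F : List V → W) : Prop :=
  ∀ a y z c, F (a ++ (y + z) :: c) = F (a ++ y :: c) + F (a ++ z :: c)

theorem AdditiveWords.cons {F : List V → W} (h : AdditiveWords F) (x : V) :
    AdditiveWords fun m => F (x :: m) :=
  fun a y z c => h (x :: a) y z c

/-- For `F` additive in each letter, evaluation at words with varying first letter. -/
def AdditiveWords.headHom {F : List V → W} (h : AdditiveWords F) (c : List V) : V →+ W :=
  AddMonoidHom.mk' (fun y => F (y :: c)) fun y z => h [] y z c

/-- For `G` additive in each letter, `insertSum σ f id G` as an additive function of `f`. -/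
def AdditiveWords.insertHom (σ : V → V) {G : List V → W} (h : AdditiveWords G) (l : List V) :
    (List V → V) →+ W :=
  AddMonoidHom.mk' (fun f => insertSum σ f id G l) <| by
    intro f g
    induction l generalizing G with
    | nil => simp [insertSum]
    | cons x l ih =>
      have h1 : ∀ b c, G ((f + g) (x :: b) :: c) = G (f (x :: b) :: c) + G (g (x :: b) :: c) :=
        fun b c => h [] _ _ c
      simp only [insertSum, ih (h.cons _), id, h1, splitSum_add]
      abel

theorem AdditiveWords.insertHom_apply (σ : V → V) {G : List V → W} (h : AdditiveWords G)
    (l : List V) (f : List V → V) : h.insertHom σ l f = insertSum σ f id G l := rfl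

/-- If `G` vanishes on words that contain a value of `θ`, inserting `θ` into `G ∘ f` is the same
as inserting it into `f`. -/
theorem insertOne_insertSum {Z : Set V} {θ : List V → V} (hZ : ∀ l, θ l ∈ Z) {σ : V → V}
    (hσ : ∀ z ∈ Z, σ z ∈ Z) (f : List V → V) {G : List V → W} (hG : Kills Z G)
    (hadd : AdditiveWords G) (l : List V) :
    insertOne θ (insertSum σ f id G) l = insertSum σ (insertOne θ f) id G l := by
  induction l generalizing G with
  | nil => rfl
  | cons x l ih =>
    have h1 : ∀ y, (fun m => insertSum σ f id G (y :: m)) = fun m =>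
        insertSum σ f id (fun m => G (σ y :: m)) m +
          splitSum m fun b c => G (f (y :: b) :: c) := fun _ => rfl
    -- A value of `θ` at the head must be swallowed by `f`: left outside, it reaches `G` as an
    -- element of `Z`.
    have h2 : ∀ b c, insertSum σ f id G (θ (x :: b) :: c) =
        splitSum c fun c₁ c₂ => G (f (θ (x :: b) :: c₁) :: c₂) := by
      intro b c
      rw [congrFun (h1 (θ (x :: b))) c, add_eq_right]
      have h0 := hG.eq_zero (hσ _ (hZ (x :: b)))
      rw [h0, insertSum_zero _ _ _ rfl]
      rfl
    have h3 : insertOne θ (insertSum σ f id G) (x :: l) =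
        insertOne θ (fun m => insertSum σ f id G (x :: m)) l +
          splitSum l fun b c => insertSum σ f id G (θ (x :: b) :: c) := rfl
    have h4 : insertOne θ (fun m => insertSum σ f id G (x :: m)) l =
        insertOne θ (insertSum σ f id fun m => G (σ x :: m)) l +
          insertOne θ (fun m => splitSum m fun b c => G (f (x :: b) :: c)) l := by
      rw [h1]
      exact insertSum_id_add _ _ _ _ _
    -- Insertions to the right of the `f`-block stay visible to `G`, so they contribute nothing.
    have h5 : ∀ b, insertOne θ (fun c => G (f (x :: b) :: c)) = 0 := fun b =>
      funext fun c => insertSum_eq_zero_of_kills id hZ (hG.cons _) c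
    have h6 : ∀ b c, insertOne θ (fun b => G (f (x :: b) :: c)) b =
        G (insertOne θ (fun b => f (x :: b)) b :: c) := fun b c =>
      insertSum_id_map id θ (hadd.headHom c) (fun b => f (x :: b)) b
    have h7 : ∀ b c, G (insertOne θ f (x :: b) :: c) =
        G (insertOne θ (fun b => f (x :: b)) b :: c) +
          splitSum b fun b₁ b₂ => G (f (θ (x :: b₁) :: b₂) :: c) := by
      intro b c
      have h8 := splitSum_map (hadd.headHom c) b fun b₁ b₂ => f (θ (x :: b₁) :: b₂)
      exact ((hadd.headHom c).map_add _ _).trans (congrArg₂ (· + ·) rfl h8.symm)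
    have h8 : insertSum σ (insertOne θ f) id G (x :: l) =
        insertSum σ (insertOne θ f) id (fun m => G (σ x :: m)) l +
          splitSum l fun b c => G (insertOne θ f (x :: b) :: c) := rfl
    rw [h3, h4, insertOne_splitSum, ih (hG.cons _) (hadd.cons _), h8]
    simp only [h2, h5, h6, h7, Pi.zero_apply, splitSum_zero, splitSum_add]
    rw [splitSum_assoc l fun b₁ b₂ c => G (f (θ (x :: b₁) :: b₂) :: c)]
    abel

/-- The iterated commutator with a nilpotent insertion `θ`. -/
theorem iterate_commutator {Z : AddSubgroup V} {θ : List V → V} (hZ : ∀ l, θ l ∈ Z)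
    (hθ : Kills Z θ) (hadd : AdditiveWords θ) {σ : V → V} (hσ : ∀ z ∈ Z, σ z ∈ Z)
    {φ : List V → V} (hφ : Kills {0} φ) (r : ℕ → List V → V) (h0 : r 0 = φ)
    (hr : ∀ k l, r (k + 1) l = insertOne θ (r k) l - insertSum σ (r k) id θ l)
    (k : ℕ) (l : List V) :
    r (k + 1) l = (k + 1).factorial •
      (insertMany θ (k + 1) φ l - insertSum σ (insertMany θ k φ) id θ l) := by
  induction k generalizing l with
  | zero => simp [hr, h0, insertMany]
  | succ k ih =>
    have e : r (k + 1) = (k + 1).factorial •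
      (insertMany θ (k + 1) φ - insertSum σ (insertMany θ k φ) id θ) := funext ih
    -- The first multiplicity comes from `insertOne_insertMany` at `k + 1`. The second comes from
    -- the same lemma at `k`, after `insertOne_insertSum` moves the new insertion under the outer
    -- `θ`.
    have h1 : insertOne θ (r (k + 1)) l = (k + 1).factorial •
        ((k + 1 + 1) • insertMany θ (k + 1 + 1) φ l -
          (k + 1) • insertSum σ (insertMany θ (k + 1) φ) id θ l) := by
      have h2 := insertSum_id_map id θ (nsmulAddMonoidHom (α := V) (k + 1).factorial)
        (fun l => insertMany θ (k + 1) φ l - insertSum σ (insertMany θ k φ) id θ l) l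
      have h3 := insertSum_id_add id θ
        (fun l => insertMany θ (k + 1) φ l - insertSum σ (insertMany θ k φ) id θ l)
        (insertSum σ (insertMany θ k φ) id θ) l
      have h4 : insertOne θ (insertMany θ k φ) = (k + 1) • insertMany θ (k + 1) φ :=
        funext fun l => insertOne_insertMany hZ hθ k hφ l
      have h5 := map_nsmul (hadd.insertHom σ l) (k + 1) (insertMany θ (k + 1) φ)
      simp only [hadd.insertHom_apply] at h5
      simp only [sub_add_cancel] at h3
      rw [e]
      refine h2.trans (congrArg _ ?_)
      rw [eq_sub_iff_add_eq, ← insertOne_insertMany hZ hθ (k + 1) hφ, ← h5, ← h4,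
        ← insertOne_insertSum hZ hσ _ hθ hadd]
      exact h3.symm
    -- The correction term in `r (k + 1)` already has values in `Z`, so the outer `θ` kills it.
    have h6 : insertSum σ (r (k + 1)) id θ l = (k + 1).factorial •
        insertSum σ (insertMany θ (k + 1) φ) id θ l := by
      rw [e, ← hadd.insertHom_apply, map_nsmul, map_sub, hadd.insertHom_apply,
        hadd.insertHom_apply, insertSum_eq_zero_of_kills σ (insertSum_mem σ (insertMany θ k φ) hZ) hθ, sub_zero]
    -- The `k + 1` copies of the correction from `h1` and the one from `h6` add up to `k + 2`, the
    -- multiplicity of the main term.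
    rw [hr, h1, h6, ← smul_sub, Nat.factorial_succ (k + 1), mul_comm, mul_smul]
    congr 1
    rw [smul_sub, succ_nsmul (insertSum _ _ _ _ _) (k + 1)]
    abel

end WordsAdd

/-! ### From insertions to sums over compositions. -/

section WordsComposition

variable {U V W Y : Type*} [AddCommGroup W]

/-- The value of `g` at the letter of a word of length one, and zero at all other words. -/
def onSingleton (b : List U) (g : U → W) : W :=
  match b with
  | [x] => g x
  | _ => 0

/-- The sum over all ways of turning `k` of the blocks `b` into the letter `τ b`, and all other
blocks, which have to be of length one, into the letter `ι x`. -/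
def choiceSum (ι : U → V) (τ : List U → V) : ℕ → (List V → W) → List (List U) → W
  | k, F, [] => if k = 0 then F [] else 0
  | 0, F, b :: L => onSingleton b fun x => choiceSum ι τ 0 (fun m => F (ι x :: m)) L
  | k + 1, F, b :: L => (onSingleton b fun x => choiceSum ι τ (k + 1) (fun m => F (ι x :: m)) L) +
      choiceSum ι τ k (fun m => F (τ b :: m)) L

/-- The sum over all ways of turning one of the blocks, of length one, into the letter `ι x`,
and all others into the letter `τ b`. -/
def markSum (ι : U → V) (τ : List U → V) : (List V → W) → List (List U) → W
  | _, [] => 0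
  | F, b :: L => (onSingleton b fun x => F (ι x :: L.map τ)) +
      markSum ι τ (fun m => F (τ b :: m)) L

/-- Sorts compositions by their first block, which has length `ab.1 + 1` because blocks are
nonempty. -/
theorem Composition.sum_blocks_succ (n : ℕ) (g : List ℕ → W) :
    ∑ c : Composition (n + 1), g c.blocks =
      ∑ ab ∈ Finset.HasAntidiagonal.antidiagonal n,
        ∑ c : Composition ab.2, g ((ab.1 + 1) :: c.blocks) := by
  rw [Finset.sum_sigma']
  symm
  refine Finset.sum_bij (fun (i : Σ ab : ℕ × ℕ, Composition ab.2) hi =>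
    ⟨(i.1.1 + 1) :: i.2.blocks, ?_, ?_⟩) (fun _ _ => Finset.mem_univ _) ?_ ?_ (fun _ _ => rfl)
  · intro j hj
    rcases List.mem_cons.1 hj with rfl | hj
    · omega
    · exact i.2.blocks_pos hj
  · have := Finset.HasAntidiagonal.mem_antidiagonal.1 (Finset.mem_sigma.1 hi).1
    rw [List.sum_cons, i.2.blocks_sum]
    omega
  · rintro ⟨⟨a, b⟩, c⟩ h ⟨⟨a', b'⟩, c'⟩ h' e
    have h := Finset.HasAntidiagonal.mem_antidiagonal.1 (Finset.mem_sigma.1 h).1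
    have h' := Finset.HasAntidiagonal.mem_antidiagonal.1 (Finset.mem_sigma.1 h').1
    have e := congrArg Composition.blocks e
    simp only [List.cons.injEq, add_left_inj] at e h h'
    obtain ⟨rfl, e⟩ := e
    obtain rfl : b = b' := by omega
    rw [Composition.ext e]
  · rintro c -
    have hpos := fun i => c.blocks_pos (i := i)
    have hsum := c.blocks_sum
    rcases hb : c.blocks with _ | ⟨k, bl⟩
    · simp [hb] at hsum
    · rw [hb] at hpos hsum
      have hk : 0 < k := hpos k List.mem_cons_self
      rw [List.sum_cons] at hsum
      refine ⟨⟨(k - 1, bl.sum), ⟨bl, fun hi => hpos _ (List.mem_cons_of_mem _ hi), rfl⟩⟩, ?_, ?_⟩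
      · simp only [Finset.mem_sigma, Finset.HasAntidiagonal.mem_antidiagonal, Finset.mem_univ,
          and_true]
        omega
      · apply Composition.ext
        simp only [hb, List.cons.injEq, and_true]
        omega

theorem sum_splitWrtComposition_nil (F : List (List U) → W) :
    ∑ c : Composition 0, F (([] : List U).splitWrtComposition c) = F [] := by
  have h : ∀ c : Composition 0, ([] : List U).splitWrtComposition c = [] := fun c =>
    List.length_eq_zero_iff.1 (by
      rw [List.length_splitWrtComposition]
      exact Nat.le_zero.1 c.length_le)
  simp [h, composition_card]

theorem sum_splitWrtComposition_cons (x : U) (l : List U) (F : List (List U) → W) :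
    ∑ c : Composition (x :: l).length, F ((x :: l).splitWrtComposition c) =
      splitSum l fun b c =>
        ∑ e : Composition c.length, F ((x :: b) :: c.splitWrtComposition e) := by
  rw [splitSum_eq_sum_antidiagonal, List.length_cons]
  refine (Composition.sum_blocks_succ l.length
    fun bl => F ((x :: l).splitWrtCompositionAux bl)).trans ?_
  refine Finset.sum_congr rfl fun ab hab => ?_
  have h : (l.drop ab.1).length = ab.2 := by
    have := Finset.HasAntidiagonal.mem_antidiagonal.1 hab
    rw [List.length_drop]
    omega
  rw [h]
  refine Finset.sum_congr rfl fun c _ => ?_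
  rw [List.splitWrtCompositionAux_cons]
  rfl

/-- Choosing `k` disjoint factors amounts to cutting the word into blocks, `k` of them selected and
the rest single letters. Removing the first block can shorten the word by any amount, hence strong
induction on the length. -/
theorem insertMany_map_list (f : List V → V) (ι : U → V) (k : ℕ) (F : List V → W)
    (l : List U) : insertMany f k F (l.map ι) =
      ∑ c : Composition l.length,
        choiceSum ι (fun b => f (b.map ι)) k F (l.splitWrtComposition c) := by
  induction hn : l.length using Nat.strong_induction_on generalizing l k F with
  | _ n ih =>
    subst hn
    have ih : ∀ (k : ℕ) (F : List V → W) (b c x) (l' : List U), l = x :: l' → b ++ c = l' →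
        insertMany f k F (c.map ι) = ∑ e : Composition c.length,
          choiceSum ι (fun b => f (b.map ι)) k F (c.splitWrtComposition e) := by
      rintro k F b c x _ rfl rfl
      exact ih c.length (by simp only [List.length_cons, List.length_append]; omega) k F c rfl
    cases l with
    | nil =>
      refine Eq.trans ?_ (sum_splitWrtComposition_nil _).symm
      cases k <;> rfl
    | cons x l =>
      rw [sum_splitWrtComposition_cons]
      -- An unreplaced first block has length one, so only the split with empty `b` survives.
      have hs : ∀ g : U → List U → W,
          (splitSum l fun b c => onSingleton (x :: b) fun y => g y c) = g x l := by
        intro g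
        rw [splitSum_eq_of_left_nil]
        · rfl
        · intros; rfl
      have ho : ∀ (b : List U) (c : List U) (g : U → Composition c.length → W),
          ∑ e : Composition c.length, onSingleton b (fun y => g y e) =
            onSingleton b fun y => ∑ e : Composition c.length, g y e := by
        intro b c g
        match b with
        | [] => simp [onSingleton]
        | [x] => rfl
        | x :: y :: b => simp [onSingleton]
      have hl := ih k (fun m => F (ι x :: m)) [] l x l rfl rfl
      cases k with
      | zero =>
        simp only [choiceSum, ho]
        rw [hs fun y c => ∑ e : Composition c.length, choiceSum ι (fun b => f (b.map ι)) 0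
          (fun m => F (ι y :: m)) (c.splitWrtComposition e)]
        exact hl
      | succ k =>
        simp only [choiceSum, Finset.sum_add_distrib, splitSum_add, ho]
        rw [hs fun y c => ∑ e : Composition c.length, choiceSum ι (fun b => f (b.map ι)) (k + 1)
          (fun m => F (ι y :: m)) (c.splitWrtComposition e)]
        refine congrArg₂ (· + ·) hl ?_
        refine (splitSum_map_list ι l _).trans ?_
        refine splitSum_congr fun b c hbc => ?_
        exact ih k (fun m => F (f ((x :: b).map ι) :: m)) b c x l rfl hbc

/-- The function `F` vanishes on the words in letters `κ a` and `ι x` unless exactly `j` letters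
are of the form `ι x`. -/
def MarkedOnly (κ : Y → V) (ι : U → V) (j : ℕ) (F : List V → W) : Prop :=
  ∀ l : List (Y ⊕ U), l.countP Sum.isRight ≠ j → F (l.map (Sum.elim κ ι)) = 0

theorem MarkedOnly.cons_left {κ : Y → V} {ι : U → V} {j : ℕ} {F : List V → W}
    (h : MarkedOnly κ ι j F) (a : Y) : MarkedOnly κ ι j fun m => F (κ a :: m) :=
  fun l hl => h (Sum.inl a :: l) (by simpa using hl)

theorem MarkedOnly.cons_right {κ : Y → V} {ι : U → V} {j : ℕ} {F : List V → W}
    (h : MarkedOnly κ ι (j + 1) F) (x : U) : MarkedOnly κ ι j fun m => F (ι x :: m) :=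
  fun l hl => h (Sum.inr x :: l) (by simpa [List.countP_cons] using hl)

theorem onSingleton_eq_zero (b : List U) {g : U → W} (h : ∀ x, g x = 0) :
    onSingleton b g = 0 := by
  match b with
  | [] => rfl
  | [x] => exact h x
  | x :: y :: b => rfl

theorem choiceSum_eq_zero (κ : Y → V) (ι : U → V) (t : List U → Y) {F : List V → W}
    (h : ∀ l : List (Y ⊕ U), F (l.map (Sum.elim κ ι)) = 0) (k : ℕ) (L : List (List U)) :
    choiceSum ι (fun b => κ (t b)) k F L = 0 := by
  induction L generalizing k F with
  | nil => simpa [choiceSum] using fun _ => h []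
  | cons b L ih =>
    have h1 := fun k x => ih (F := fun m => F (ι x :: m)) (fun l => h (Sum.inr x :: l)) k
    have h2 := fun k => ih (F := fun m => F (κ (t b) :: m)) (fun l => h (Sum.inl (t b) :: l)) k
    cases k with
    | zero => exact onSingleton_eq_zero b (h1 0)
    | succ k =>
      simp only [choiceSum]
      rw [onSingleton_eq_zero b (h1 (k + 1)), h2, add_zero]

/-- `F` tolerates no bare letter, so all blocks must be selected. -/
theorem choiceSum_of_markedOnly_zero {κ : Y → V} {ι : U → V} (t : List U → Y) {F : List V → W}
    (h : MarkedOnly κ ι 0 F) (k : ℕ) (L : List (List U)) :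
    choiceSum ι (fun b => κ (t b)) k F L =
      if L.length = k then F (L.map fun b => κ (t b)) else 0 := by
  induction L generalizing k F with
  | nil => simp [choiceSum, eq_comm]
  | cons b L ih =>
    have h1 : ∀ k x, choiceSum ι (fun b => κ (t b)) k (fun m => F (ι x :: m)) L = 0 := by
      intro k x
      refine choiceSum_eq_zero κ ι t (fun l => h (Sum.inr x :: l) ?_) k L
      simp
    cases k with
    | zero =>
      simp only [choiceSum]
      rw [onSingleton_eq_zero b (h1 0)]
      simp
    | succ k =>
      simp only [choiceSum]
      rw [onSingleton_eq_zero b (h1 (k + 1)), ih (h.cons_left (t b))]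
      simp

/-- Exactly one block stays bare. Once it has been met, the remainder falls under
`choiceSum_of_markedOnly_zero`. -/
theorem choiceSum_of_markedOnly_one {κ : Y → V} {ι : U → V} (t : List U → Y) {F : List V → W}
    (h : MarkedOnly κ ι 1 F) (k : ℕ) (L : List (List U)) :
    choiceSum ι (fun b => κ (t b)) k F L =
      if L.length = k + 1 then markSum ι (fun b => κ (t b)) F L else 0 := by
  induction L generalizing k F with
  | nil =>
    have : F [] = 0 := h [] (by simp)
    simp [choiceSum, this]
  | cons b L ih =>
    have h1 : ∀ k x, choiceSum ι (fun b => κ (t b)) k (fun m => F (ι x :: m)) L =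
        if L.length = k then F (ι x :: L.map fun b => κ (t b)) else 0 := fun k x =>
      choiceSum_of_markedOnly_zero t (h.cons_right x) k L
    cases k with
    | zero =>
      simp only [choiceSum, h1]
      cases L with
      | nil => simp [markSum]
      | cons c L => simpa using onSingleton_eq_zero b fun _ => rfl
    | succ k =>
      simp only [choiceSum, h1, markSum, ih (h.cons_left (t b)), List.length_cons,
        add_left_inj]
      split_ifs
      · rfl
      · rw [onSingleton_eq_zero b fun _ => rfl, add_zero]

theorem sum_insertMany_of_markedOnly_zero (f : List V → V) {κ : Y → V} {ι : U → V}
    (t : List U → Y) (hf : ∀ b, f (b.map ι) = κ (t b)) {F : List V → W}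
    (h : MarkedOnly κ ι 0 F) {l : List U} (hl : l ≠ []) {N : ℕ} (hN : l.length ≤ N) :
    ∑ k ∈ Finset.range N, insertMany f (k + 1) F (l.map ι) =
      ∑ c : Composition l.length, F ((l.splitWrtComposition c).map fun b => κ (t b)) := by
  simp only [insertMany_map_list, hf]
  rw [Finset.sum_comm]
  refine Finset.sum_congr rfl fun c _ => ?_
  simp only [choiceSum_of_markedOnly_zero t h, List.length_splitWrtComposition]
  -- Each composition contributes for one `k` only, namely `c.length - 1`; it lies in the range
  -- since there are at most `l.length` blocks.
  have hc := c.length_pos_of_pos (List.length_pos_iff.2 hl)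
  obtain ⟨j, hj⟩ := Nat.exists_eq_succ_of_ne_zero hc.ne'
  have := c.length_le
  simp only [hj, Nat.succ_eq_add_one, add_left_inj]
  rw [Finset.sum_ite_eq, if_pos]
  exact Finset.mem_range.2 (by omega)

theorem sum_insertMany_of_markedOnly_one (f : List V → V) {κ : Y → V} {ι : U → V}
    (t : List U → Y) (hf : ∀ b, f (b.map ι) = κ (t b)) {F : List V → W}
    (h : MarkedOnly κ ι 1 F) {l : List U} {N : ℕ} (hN : l.length ≤ N) :
    ∑ k ∈ Finset.range N, insertMany f k F (l.map ι) =
      ∑ c : Composition l.length, markSum ι (fun b => κ (t b)) F (l.splitWrtComposition c) := by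
  simp only [insertMany_map_list, hf]
  rw [Finset.sum_comm]
  refine Finset.sum_congr rfl fun c _ => ?_
  simp only [choiceSum_of_markedOnly_one t h, List.length_splitWrtComposition]
  by_cases h0 : c.length = 0
  · have : l.splitWrtComposition c = [] := List.length_eq_zero_iff.1 (by simp [h0])
    simp [this, markSum]
  · obtain ⟨j, hj⟩ := Nat.exists_eq_succ_of_ne_zero h0
    have := c.length_le
    simp only [hj, Nat.succ_eq_add_one, add_left_inj]
    rw [Finset.sum_ite_eq, if_pos]
    exact Finset.mem_range.2 (by omega)

theorem List.splitWrtComposition_ofFn {p : ℕ} (u : Fin p → U) (c : Composition p) :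
    (List.ofFn u).splitWrtComposition c =
      List.ofFn fun r : Fin c.length => List.ofFn (u ∘ c.embedding r) := by
  refine List.ext_getElem (by simp) fun i h₁ h₂ => ?_
  have hi : i < c.length := by simpa using h₁
  rw [List.getElem_splitWrtComposition]
  have hs := c.sizeUpTo_succ hi
  have hle := c.sizeUpTo_le (i + 1)
  have hb : c.blocksFun ⟨i, hi⟩ = c.blocks[i] := rfl
  refine List.ext_getElem ?_ fun j h₃ h₄ => ?_
  · simp only [List.length_drop, List.length_take, List.length_ofFn, List.getElem_ofFn]
    omega
  · simp only [List.getElem_drop, List.getElem_take, List.getElem_ofFn, Function.comp]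
    congr 1

theorem markSum_ofFn (ι : U → V) (τ : List U → V) (F : List V → W) {n : ℕ}
    (g : Fin n → List U) :
    markSum ι τ F (List.ofFn g) = ∑ i : Fin n, onSingleton (g i) fun x =>
      F (List.ofFn fun r => if r = i then ι x else τ (g r)) := by
  induction n generalizing F with
  | zero => simp [markSum]
  | succ n ih =>
    rw [List.ofFn_succ, markSum, ih, Fin.sum_univ_succ]
    congr 1
    · congr 1
      funext x
      congr 1
      rw [List.ofFn_succ, List.map_ofFn]
      simp [Function.comp_def]
    · refine Finset.sum_congr rfl fun i _ => ?_
      congr 1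
      funext x
      rw [List.ofFn_succ]
      simp [(Fin.succ_ne_zero _).symm]

end WordsComposition

/-! ### Families of multilinear maps as functions on words. -/

section TensorWords

variable {K V W : Type*} [Field K] [AddCommGroup V] [Module K V] [AddCommGroup W] [Module K W]

/-- The value of a family of multilinear maps at a word. -/
def evalList (f : TensorHom K V W) (l : List V) : W := f l.length l.get

theorem TensorHom.congr_arity (f : TensorHom K V W) {n m : ℕ} (h : n = m) {a : Fin n → V}
    {b : Fin m → V} (hab : ∀ i, a i = b (Fin.cast h i)) : f n a = f m b := by
  subst h
  exact congrArg _ (funext hab)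

theorem evalList_ofFn (f : TensorHom K V W) {n : ℕ} (a : Fin n → V) :
    evalList f (List.ofFn a) = f n a :=
  f.congr_arity List.length_ofFn fun i => by simp; rfl

theorem evalList_nil (f : TensorHom K V W) : evalList f [] = 0 ↔ f 0 = 0 := by
  refine ⟨fun h => ?_, fun h => by simp [evalList, h]⟩
  ext v
  rw [Subsingleton.elim v ([] : List V).get]
  exact h

theorem kills_evalList (f : TensorHom K V W) : Kills {0} (evalList f) := by
  rintro l z hz rfl
  obtain ⟨i, hi⟩ := List.get_of_mem hz
  exact (f l.length).map_coord_zero i hi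

theorem additiveWords_evalList (f : TensorHom K V W) : AdditiveWords (evalList f) := by
  intro a y z c
  have hl : ∀ y : V, (a ++ y :: c).length = a.length + 1 + c.length := fun y => by
    simp only [List.length_append, List.length_cons]; omega
  let w : Fin (a.length + 1 + c.length) → V := fun r =>
    (a ++ 0 :: c).get (Fin.cast (hl 0).symm r)
  have h : ∀ y : V, evalList f (a ++ y :: c) =
      f _ (Function.update w ⟨a.length, by omega⟩ y) := by
    intro y
    refine f.congr_arity (hl y) fun i => ?_
    simp only [w, Function.update_apply, Fin.ext_iff, Fin.val_cast, List.get_eq_getElem,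
      List.getElem_append]
    by_cases h1 : (i : ℕ) < a.length
    · simp [h1, h1.ne]
    · by_cases h2 : (i : ℕ) = a.length
      · simp [h2]
      · obtain ⟨j, hj⟩ : ∃ j, (i : ℕ) - a.length = j + 1 := ⟨i - a.length - 1, by omega⟩
        simp [h1, h2, hj]
  simp only [h, MultilinearMap.map_update_add]

theorem Cut.sum_eq_antidiagonal (N : ℕ) (φ : ℕ → ℕ → ℕ → W) :
    ∑ x : Cut N, φ x.left x.mid x.right =
      ∑ ab ∈ Finset.HasAntidiagonal.antidiagonal N,
        ∑ cd ∈ Finset.HasAntidiagonal.antidiagonal ab.2, φ ab.1 cd.1 cd.2 := by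
  rw [Finset.sum_sigma']
  refine Finset.sum_bij
    (fun x _ => (⟨(x.left, x.mid + x.right), (x.mid, x.right)⟩ : Σ _ : ℕ × ℕ, ℕ × ℕ))
    ?_ ?_ ?_ fun _ _ => rfl
  · intro x _
    have := x.sum_eq
    simp only [Finset.mem_sigma, Finset.HasAntidiagonal.mem_antidiagonal, and_true]
    omega
  · intro x _ y _ h
    simp only [Sigma.mk.injEq, Prod.mk.injEq, heq_eq_eq] at h
    refine Subtype.ext (Prod.ext (Fin.ext h.1.1) (Prod.ext (Fin.ext h.2.1) (Fin.ext h.2.2)))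
  · rintro ⟨⟨a, b⟩, ⟨c, d⟩⟩ h
    simp only [Finset.mem_sigma, Finset.HasAntidiagonal.mem_antidiagonal] at h
    obtain ⟨h1, rfl⟩ := h
    exact ⟨⟨(⟨a, by omega⟩, ⟨c, by omega⟩, ⟨d, by omega⟩), by simp only; omega⟩,
      Finset.mem_univ _, rfl⟩

theorem insertSum_eq_sum_antidiagonal (σ : V → V) (g : List V → V) (hg : g [] = 0)
    {F : List V → W} (hF : Kills {0} F) (l : List V) :
    insertSum σ g id F l = ∑ ab ∈ Finset.HasAntidiagonal.antidiagonal l.length,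
      ∑ cd ∈ Finset.HasAntidiagonal.antidiagonal ab.2,
        F ((l.take ab.1).map σ ++ g ((l.drop ab.1).take cd.1) :: l.drop (ab.1 + cd.1)) := by
  induction l generalizing F with
  -- The right side also allows an empty inserted factor; it produces the letter `g [] = 0`, which
  -- `F` kills.
  | nil => simpa [insertSum, hg] using (hF [0] 0 (by simp) rfl).symm
  | cons x l ih =>
    have h0 : F (0 :: x :: l) = 0 := hF _ 0 List.mem_cons_self rfl
    have e : ∀ n m : ℕ, (n + 1 + m) = n + m + 1 := fun n m => by omega
    simp only [insertSum, ih (hF.cons _), List.length_cons, Finset.Nat.sum_antidiagonal_succ,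
      splitSum_eq_sum_antidiagonal, id]
    simp [hg, h0, e, add_comm]

theorem insertSum_ofFn (σ : V → V) (g : List V → V) (hg : g [] = 0)
    {F : List V → W} (hF : Kills {0} F) {N : ℕ} (a : Fin N → V) :
    insertSum σ g id F (List.ofFn a) = ∑ x : Cut N, F (List.ofFn
      (x.splice (fun r => if (r : ℕ) < x.left then σ (a r) else a r)
        (g (List.ofFn (x.block a))))) := by
  rw [insertSum_eq_sum_antidiagonal σ g hg hF, List.length_ofFn, ← Cut.sum_eq_antidiagonal N
    fun i m _ => F (((List.ofFn a).take i).map σ ++ g (((List.ofFn a).drop i).take m) ::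
      (List.ofFn a).drop (i + m))]
  refine Finset.sum_congr rfl fun x _ => congrArg F ?_
  have hx := x.sum_eq
  have h1 : ((List.ofFn a).drop x.left).take x.mid = List.ofFn (x.block a) := by
    refine List.ext_getElem (by simp; omega) fun i h₁ h₂ => ?_
    simp [Cut.block]
  rw [h1]
  refine List.ext_getElem (by simp; omega) fun i h₁ h₂ => ?_
  simp only [List.getElem_append, List.getElem_ofFn, Cut.splice]
  have hm : min x.left N = x.left := by omega
  simp only [List.length_map, List.length_take, List.length_ofFn, hm, List.getElem_map,
    List.getElem_take, List.getElem_ofFn]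
  by_cases h2 : i < x.left
  · simp [h2]
  · by_cases h3 : i = x.left
    · simp [h3]
    · obtain ⟨j, hj⟩ : ∃ j, i - x.left = j + 1 := ⟨i - x.left - 1, by omega⟩
      have h4 : ¬ (i - 1 + x.mid < x.left) := by omega
      simp only [h2, h3, h4, dite_false, if_false, hj, List.getElem_cons_succ,
        List.getElem_drop, List.getElem_ofFn]
      congr 2
      omega

theorem koszulSign_of_mem (𝒱 : ℤ → Submodule K V) [DirectSum.Decomposition 𝒱] (n : ℤ) {i : ℤ}
    {v : V} (hv : v ∈ 𝒱 i) : koszulSign 𝒱 n v = ((-1 : K) ^ (n * i)) • v := by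
  have h := DirectSum.decomposeLinearEquiv_apply_coe (R := K) 𝒱 i ⟨v, hv⟩
  simp only at h
  simp [koszulSign, h]

theorem koszulSign_zero (𝒱 : ℤ → Submodule K V) [DirectSum.Decomposition 𝒱] (v : V) :
    koszulSign 𝒱 0 v = v := by
  induction v using DirectSum.Decomposition.inductionOn 𝒱 with
  | zero => exact map_zero _
  | homogeneous v => simpa using koszulSign_of_mem 𝒱 0 v.2
  | add v w hv hw => rw [map_add, hv, hw]

theorem evalList_circ (𝒱 : ℤ → Submodule K V) [DirectSum.Decomposition 𝒱] (n : ℤ)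
    (f : TensorHom K V V) {g : TensorHom K V V} (hg : g 0 = 0) (l : List V) :
    evalList (circ 𝒱 n f g) l =
      insertSum (koszulSign 𝒱 n) (evalList g) id (evalList f) l := by
  obtain ⟨N, a, rfl⟩ : ∃ (N : ℕ) (a : Fin N → V), l = List.ofFn a :=
    ⟨l.length, l.get, (List.ofFn_get l).symm⟩
  rw [insertSum_ofFn _ _ ((evalList_nil g).2 hg) (kills_evalList f)]
  simp only [evalList_ofFn, circ, sum_apply]
  rfl

/-- Since `g` has degree $0$, the only sign left is the Koszul sign of `f` passing letters inside
`g`. -/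
theorem evalList_gBracket_one_zero (𝒱 : ℤ → Submodule K V) [DirectSum.Decomposition 𝒱]
    {f g : TensorHom K V V} (hf : f 0 = 0) (hg : g 0 = 0) (l : List V) :
    evalList (gBracket 𝒱 1 0 f g) l = insertOne (evalList g) (evalList f) l -
      insertSum (koszulSign 𝒱 1) (evalList f) id (evalList g) l := by
  have h0 : (koszulSign 𝒱 0 : V → V) = id := funext (koszulSign_zero 𝒱)
  rw [insertOne, ← h0, ← evalList_circ 𝒱 0 f hg, ← evalList_circ 𝒱 1 g hf]
  simp [gBracket, evalList]

/-- A multilinear map that vanishes on homogeneous arguments is zero. -/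
theorem MultilinearMap.eq_zero_of_homogeneous (𝒱 : ℤ → Submodule K V)
    [DirectSum.Decomposition 𝒱] {p : ℕ} (f : MultilinearMap K (fun _ : Fin p => V) W)
    (h : ∀ (d : Fin p → ℤ) (v : Fin p → V), (∀ r, v r ∈ 𝒱 (d r)) → f v = 0) : f = 0 := by
  classical
  ext v
  have hv : v = fun r => ∑ i ∈ (DirectSum.decompose 𝒱 (v r)).support,
      (DirectSum.decompose 𝒱 (v r) i : V) :=
    funext fun r => (DirectSum.sum_support_decompose 𝒱 (v r)).symm
  rw [hv, MultilinearMap.map_sum_finset]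
  exact Finset.sum_eq_zero fun d _ => h d _ fun r => SetLike.coe_mem _

end TensorWords

/-! ### The derived brackets of $T$ with itself. -/

section DerivedBrackets

variable {K A M : Type*} [Field K] [AddCommGroup A] [Module K A] [AddCommGroup M] [Module K M]
  (𝒜 : ℤ → Submodule K A) (ℳ : ℤ → Submodule K M) {μ : TensorHom K A A}
  {η : TensorHom K (A × M) M} {T : TensorHom K M A}

/-- Koszul signs preserve $A$, as `iterate_commutator` requires of `σ`. -/
theorem koszulSign_prodGrading_snd [DirectSum.Decomposition 𝒜] [DirectSum.Decomposition ℳ]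
    (n : ℤ) (a : A) : (koszulSign (prodGrading 𝒜 ℳ) n (a, 0)).2 = 0 := by
  induction a using DirectSum.Decomposition.inductionOn 𝒜 with
  | zero => exact congrArg Prod.snd (map_zero (koszulSign (prodGrading 𝒜 ℳ) n))
  | @homogeneous i a =>
    have h : ((a : A), (0 : M)) ∈ prodGrading 𝒜 ℳ i := ⟨a.2, (ℳ i).zero_mem⟩
    rw [koszulSign_of_mem _ n h]
    simp
  | add a b ha hb =>
    have : (a + b, (0 : M)) = (a, 0) + (b, 0) := by simp
    rw [this, map_add, Prod.snd_add, ha, hb, add_zero]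

theorem evalList_inclA_snd (T : TensorHom K M A) (l : List (A × M)) :
    evalList (inclA T) l ∈ (AddMonoidHom.snd A M).ker :=
  (AddMonoidHom.mem_ker).2 rfl

theorem kills_evalList_inclA (T : TensorHom K M A) :
    Kills ((AddMonoidHom.snd A M).ker : Set (A × M)) (evalList (inclA T)) := by
  intro l z hz hzZ
  obtain ⟨i, hi⟩ := List.get_of_mem hz
  have h0 : (l.get i).2 = 0 := by rw [hi]; exact hzZ
  have : T l.length (fun r => (l.get r).2) = 0 := (T l.length).map_coord_zero i h0
  exact Prod.ext this rfl

theorem evalList_inclA_map_inr (T : TensorHom K M A) (b : List M) :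
    evalList (inclA T) (b.map fun m => ((0 : A), m)) = (evalList T b, 0) := by
  refine Prod.ext ?_ rfl
  exact T.congr_arity (by simp) fun i => by simp

theorem evalList_structureElement_fst (μ : TensorHom K A A) (η : TensorHom K (A × M) M)
    (l : List (A × M)) :
    (evalList (structureElement μ η) l).1 = evalList μ (l.map Prod.fst) := by
  refine (add_zero _).trans ?_
  exact μ.congr_arity (by simp) fun i => by simp

theorem evalList_structureElement_snd (μ : TensorHom K A A) (η : TensorHom K (A × M) M)
    (l : List (A × M)) : (evalList (structureElement μ η) l).2 = evalList η l :=
  zero_add _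

theorem markedOnly_structureElement_fst (μ : TensorHom K A A) (η : TensorHom K (A × M) M) :
    MarkedOnly (fun a : A => (a, (0 : M))) (fun m : M => ((0 : A), m)) 0
      fun l => AddMonoidHom.fst A M (evalList (structureElement μ η) l) := by
  intro l hl
  obtain ⟨s, hs, hs'⟩ := List.countP_pos_iff.1 (Nat.pos_of_ne_zero hl)
  refine (evalList_structureElement_fst μ η _).trans (kills_evalList μ _ 0 ?_ rfl)
  obtain ⟨m, rfl⟩ := Sum.isRight_iff.1 hs'
  simp only [List.map_map, List.mem_map]
  exact ⟨_, hs, rfl⟩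

theorem List.card_filter_getElem {X : Type*} (p : X → Bool) (l : List X) :
    (Finset.univ.filter fun r : Fin l.length => p (l.get r)).card = l.countP p := by
  induction l with
  | nil => rfl
  | cons x l ih =>
    rw [List.countP_cons, ← ih]
    refine (Fin.card_filter_univ_succ _).trans ?_
    cases h : p x <;> simp [h]

/-- This is where `horizontal` enters: $\eta$ vanishes unless exactly one argument comes from $M$.
-/
theorem markedOnly_structureElement_snd {𝒜 : ℤ → Submodule K A} {ℳ : ℤ → Submodule K M}
    (hη : IsAInfinityOneBimodule 𝒜 ℳ μ η) :
    MarkedOnly (fun a : A => (a, (0 : M))) (fun m : M => ((0 : A), m)) 1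
      fun l => AddMonoidHom.snd A M (evalList (structureElement μ η) l) := by
  intro l hl
  refine (evalList_structureElement_snd μ η _).trans ?_
  have h1 : evalList η (l.map (Sum.elim (fun a : A => (a, (0 : M))) fun m : M => ((0 : A), m))) =
      η l.length fun r => Sum.elim (fun a : A => (a, (0 : M))) (fun m : M => ((0 : A), m))
        (l.get r) := η.congr_arity (by simp) fun i => by simp
  rw [h1]
  refine hη.horizontal _ (Finset.univ.filter fun r => (l.get r).isRight) _ ?_ ?_ ?_
  · intro r hr
    obtain ⟨m, hm⟩ := Sum.isRight_iff.1 (Finset.mem_filter.1 hr).2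
    simp only [hm, Sum.elim_inr]
  · intro r hr
    have : ¬ (l.get r).isRight := fun h => hr (Finset.mem_filter.2 ⟨Finset.mem_univ _, h⟩)
    obtain ⟨a, ha⟩ := Sum.isLeft_iff.1 (Sum.not_isRight.1 this)
    simp only [ha, Sum.elim_inl]
  · rwa [List.card_filter_getElem]

variable [DirectSum.Decomposition 𝒜] [DirectSum.Decomposition ℳ]

theorem nestedBracket_replicate (T : TensorHom K M A) (k : ℕ)
    (f : TensorHom K (A × M) (A × M)) :
    nestedBracket 𝒜 ℳ 1 f (List.replicate k (0, T)) =
      (fun f => gBracket (prodGrading 𝒜 ℳ) 1 0 f (inclA T))^[k] f := by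
  induction k generalizing f with
  | zero => rfl
  | succ k ih =>
    rw [List.replicate_succ, nestedBracket, add_zero, ih]
    rfl

/-- The derived brackets `l_k (T, …, T)` as insertions of `T`. -/
theorem derivedBracket_replicate_succ (hΔ : structureElement μ η 0 = 0) (hT : T 0 = 0) (k p : ℕ)
    (u : Fin p → M) :
    derivedBracket 𝒜 ℳ μ η (List.replicate (k + 1) (0, T)) p u = (k + 1).factorial •
      (insertMany (evalList (inclA T)) (k + 1) (evalList (structureElement μ η))
          (List.ofFn fun r => ((0 : A), u r)) -
        insertSum (koszulSign (prodGrading 𝒜 ℳ) 1)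
          (insertMany (evalList (inclA T)) k (evalList (structureElement μ η))) id
          (evalList (inclA T)) (List.ofFn fun r => ((0 : A), u r))).1 := by
  have hθ : inclA T 0 = 0 := (evalList_nil _).1 (Prod.ext (by simp [evalList, inclA, hT]) rfl)
  set R := fun f => gBracket (prodGrading 𝒜 ℳ) 1 0 f (inclA T) with hR
  have h0 : ∀ k, (R^[k] (structureElement μ η)) 0 = 0 := by
    intro k
    induction k with
    | zero => exact hΔ
    | succ k ih =>
      rw [Function.iterate_succ_apply', ← evalList_nil, hR, evalList_gBracket_one_zero _ ih hθ]
      simp [insertOne, insertSum]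
  have h := iterate_commutator (Z := (AddMonoidHom.snd A M).ker)
    (evalList_inclA_snd T) (kills_evalList_inclA T) (additiveWords_evalList (inclA T))
    (σ := koszulSign (prodGrading 𝒜 ℳ) 1)
    (by
      rintro ⟨a, m⟩ (rfl : m = 0)
      exact koszulSign_prodGrading_snd 𝒜 ℳ 1 a)
    (kills_evalList (structureElement μ η)) (fun k => evalList (R^[k] (structureElement μ η))) rfl
    (by
      intro k l
      simp only [Function.iterate_succ_apply']
      exact evalList_gBracket_one_zero _ (h0 k) hθ l) k (List.ofFn fun r => ((0 : A), u r))
  rw [evalList_ofFn] at h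
  rw [derivedBracket, nestedBracket_replicate, ← Prod.smul_fst, ← h]
  rfl

theorem sum_derivedBracket [CharZero K] (hΔ : structureElement μ η 0 = 0) (hT : T 0 = 0)
    (N p : ℕ) (u : Fin p → M) :
    (∑ k ∈ Finset.Icc 1 N, ((k.factorial : K)⁻¹) •
      derivedBracket 𝒜 ℳ μ η (List.replicate k (0, T))) p u =
      ∑ k ∈ Finset.range N, (insertMany (evalList (inclA T)) (k + 1)
        (evalList (structureElement μ η)) (List.ofFn fun r => ((0 : A), u r))).1 -
      (insertSum (koszulSign (prodGrading 𝒜 ℳ) 1)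
        (∑ k ∈ Finset.range N, insertMany (evalList (inclA T)) k
          (evalList (structureElement μ η))) id
        (evalList (inclA T)) (List.ofFn fun r => ((0 : A), u r))).1 := by
  have h1 : Finset.Icc 1 N = Finset.Ico (0 + 1) (N + 1) := by ext; simp
  -- Characteristic zero makes the factorials invertible.
  have h3 : ∀ (k : ℕ) (a : A), ((k.factorial : K)⁻¹) • (k.factorial • a) = a := by
    intro k a
    rw [← Nat.cast_smul_eq_nsmul K, smul_smul, inv_mul_cancel₀, one_smul]
    exact_mod_cast k.factorial_ne_zero
  rw [h1, ← Finset.sum_Ico_add', Finset.range_eq_Ico,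
    ← (additiveWords_evalList (inclA T)).insertHom_apply, map_sum, Prod.fst_sum,
    ← Finset.sum_sub_distrib, Finset.sum_apply, sum_apply]
  refine Finset.sum_congr rfl fun k _ => ?_
  rw [Pi.smul_apply, smul_apply, derivedBracket_replicate_succ 𝒜 ℳ hΔ hT, h3]
  rfl

end DerivedBrackets

/-! ### Identification of the two sides of the identity. -/

section RotaBaxterIdentity

variable {K A M : Type*} [Field K] [AddCommGroup A] [Module K A] [AddCommGroup M] [Module K M]
  {𝒜 : ℤ → Submodule K A} {ℳ : ℤ → Submodule K M} {μ : TensorHom K A A}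
  {η : TensorHom K (A × M) M} {T : TensorHom K M A}

theorem onSingleton_ofFn {U W : Type*} [AddCommGroup W] {b : ℕ} (hb : 0 < b) (w : Fin b → U)
    (g : U → W) : onSingleton (List.ofFn w) g = if b = 1 then g (w ⟨0, hb⟩) else 0 := by
  match b, hb with
  | 1, _ => simp [onSingleton]
  | b + 2, _ => simp [onSingleton, List.ofFn_succ]

theorem sum_insertMany_fst (μ : TensorHom K A A) (η : TensorHom K (A × M) M)
    (T : TensorHom K M A) {p N : ℕ} (hp : 1 ≤ p) (hN : p ≤ N) (u : Fin p → M) :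
    ∑ k ∈ Finset.range N, (insertMany (evalList (inclA T)) (k + 1)
        (evalList (structureElement μ η)) (List.ofFn fun r => ((0 : A), u r))).1 =
      rotaBaxterLHS μ T p u := by
  have h := sum_insertMany_of_markedOnly_zero (evalList (inclA T)) (evalList T)
    (evalList_inclA_map_inr T) (markedOnly_structureElement_fst μ η) (l := List.ofFn u) (N := N)
    (by rw [← List.length_pos_iff, List.length_ofFn]; exact hp) (by simpa using hN)
  simp only [insertMany_map, List.map_ofFn] at h
  refine h.trans ?_
  rw [rotaBaxterLHS, List.length_ofFn]
  refine Finset.sum_congr rfl fun c _ => ?_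
  rw [List.splitWrtComposition_ofFn, List.map_ofFn]
  refine (evalList_structureElement_fst μ η _).trans ?_
  rw [List.map_ofFn, evalList_ofFn]
  simp only [Function.comp_def, evalList_ofFn]

theorem sum_insertMany_snd (hη : IsAInfinityOneBimodule 𝒜 ℳ μ η) (T : TensorHom K M A)
    {n N : ℕ} (hN : n ≤ N) (u : Fin n → M) :
    ((∑ k ∈ Finset.range N, insertMany (evalList (inclA T)) k
        (evalList (structureElement μ η))) (List.ofFn fun r => ((0 : A), u r))).2 =
      ∑ c : Composition n, ∑ i : Fin c.length, if c.blocksFun i = 1 then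
        η c.length fun r =>
          if r = i then (0, u (c.embedding i ⟨0, c.one_le_blocksFun i⟩))
          else (T (c.blocksFun r) (u ∘ c.embedding r), 0) else 0 := by
  have h := sum_insertMany_of_markedOnly_one (evalList (inclA T)) (evalList T)
    (evalList_inclA_map_inr T) (markedOnly_structureElement_snd hη) (l := List.ofFn u) (N := N)
    (by simpa using hN)
  simp only [insertMany_map, List.map_ofFn] at h
  rw [Finset.sum_apply, Prod.snd_sum]
  refine h.trans ?_
  rw [List.length_ofFn]
  refine Finset.sum_congr rfl fun c _ => ?_
  rw [List.splitWrtComposition_ofFn, markSum_ofFn]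
  refine Finset.sum_congr rfl fun i _ => ?_
  rw [onSingleton_ofFn (c.one_le_blocksFun i)]
  refine if_congr Iff.rfl ?_ rfl
  refine (evalList_structureElement_snd μ η _).trans ?_
  simp only [evalList_ofFn, Function.comp_apply]

/-- Writes the sign as a product of one scalar per slot, so that `MultilinearMap.map_smul_univ` can
take it out of $T$. -/
theorem Cut.prod_splice_sign {K : Type*} [Field K] {N : ℕ} (x : Cut N) (d : Fin N → ℤ) :
    ∏ r : Fin (x.left + 1 + x.right),
      x.splice (fun r => if (r : ℕ) < x.left then (-1 : K) ^ d r else 1) 1 r =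
      (-1 : K) ^ x.leftDeg d := by
  have hx := x.sum_eq
  have h1 : ∀ n : ℕ, ∀ f : Fin n → K, x.left ≤ n →
      (∀ r : Fin n, x.left ≤ (r : ℕ) → f r = 1) → (∀ r : Fin n, ∀ h : (r : ℕ) < x.left,
        f r = (-1 : K) ^ d ⟨r, by omega⟩) →
      ∏ r, f r = ∏ r : Fin x.left, (-1 : K) ^ d ⟨r, by omega⟩ := by
    intro n f hn hf hf'
    obtain ⟨m, rfl⟩ := Nat.exists_eq_add_of_le hn
    rw [Fin.prod_univ_add, Finset.prod_eq_one (s := Finset.univ)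
      (f := fun i : Fin m => f (Fin.natAdd _ i)), mul_one]
    · exact Finset.prod_congr rfl fun r _ => hf' _ r.2
    · intro r _
      exact hf _ (by simp)
  have h2 : (-1 : K) ^ x.leftDeg d =
      ∏ r : Fin N, if (r : ℕ) < x.left then (-1 : K) ^ d r else 1 := by
    have : ∀ (s : Finset (Fin N)) (e : Fin N → ℤ),
        (-1 : K) ^ (∑ r ∈ s, e r) = ∏ r ∈ s, (-1 : K) ^ e r := by
      intro s e
      induction s using Finset.cons_induction with
      | empty => simp
      | cons a s ha ih =>
        rw [Finset.sum_cons, Finset.prod_cons, zpow_add₀ (by simp), ih]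
    rw [Cut.leftDeg, this]
    refine Finset.prod_congr rfl fun r _ => ?_
    split_ifs <;> simp
  rw [h2]
  refine (h1 _ _ (by omega) (fun r h => ?_) fun r h => ?_).trans
    (h1 _ _ (by omega) (fun r h => ?_) fun r h => ?_).symm
  · simp only [Cut.splice]
    split_ifs <;> first | rfl | omega
  · simp [Cut.splice, h]
  · simp [Nat.not_lt.2 h]
  · simp [h]

theorem insertSum_inclA_fst [DirectSum.Decomposition 𝒜] [DirectSum.Decomposition ℳ]
    (T : TensorHom K M A) (g : List (A × M) → A × M) (hg : g [] = 0) {p : ℕ} (d : Fin p → ℤ)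
    (u : Fin p → M) (hu : ∀ r, u r ∈ ℳ (d r)) :
    (insertSum (koszulSign (prodGrading 𝒜 ℳ) 1) g id (evalList (inclA T))
      (List.ofFn fun r => ((0 : A), u r))).1 =
      ∑ x : Cut p, ((-1 : K) ^ x.leftDeg d) • T (x.left + 1 + x.right)
        (x.splice u (g (List.ofFn (fun r => ((0 : A), x.block u r)))).2) := by
  rw [insertSum_ofFn _ g hg (kills_evalList _), Prod.fst_sum]
  refine Finset.sum_congr rfl fun x _ => ?_
  rw [evalList_ofFn, ← Cut.prod_splice_sign, ← MultilinearMap.map_smul_univ]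
  refine congrArg (T _) (funext fun r => ?_)
  have hk : ∀ r, koszulSign (prodGrading 𝒜 ℳ) 1 ((0 : A), u r) =
      ((-1 : K) ^ d r) • ((0 : A), u r) := by
    intro r
    have h : ((0 : A), u r) ∈ prodGrading 𝒜 ℳ (d r) := ⟨(𝒜 _).zero_mem, hu r⟩
    rw [koszulSign_of_mem _ 1 h, one_mul]
  have hb : (x.block fun r => ((0 : A), u r)) = fun r => ((0 : A), x.block u r) := rfl
  simp only [LinearMap.snd_apply, Cut.splice, hk, hb]
  split_ifs <;> simp

theorem sum_derivedBracket_eq [DirectSum.Decomposition 𝒜] [DirectSum.Decomposition ℳ]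
    [CharZero K] (hμ : IsAInfinityOneAlgebra 𝒜 μ) (hη : IsAInfinityOneBimodule 𝒜 ℳ μ η)
    (hT : T ∈ homDeg ℳ 𝒜 0) {p N : ℕ} (hp : 1 ≤ p) (hN : p ≤ N) (d : Fin p → ℤ)
    (u : Fin p → M) (hu : ∀ r, u r ∈ ℳ (d r)) :
    (∑ k ∈ Finset.Icc 1 N, ((k.factorial : K)⁻¹) •
      derivedBracket 𝒜 ℳ μ η (List.replicate k (0, T))) p u =
      rotaBaxterLHS μ T p u - rotaBaxterRHS η T p d u := by
  have hΔ : structureElement μ η 0 = 0 := by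
    ext v <;> simp [structureElement, hμ.degree_one.1, hη.degree_one.1]
  rw [sum_derivedBracket 𝒜 ℳ hΔ hT.1, sum_insertMany_fst μ η T hp hN,
    insertSum_inclA_fst T _ _ d u hu]
  · congr 1
    rw [rotaBaxterRHS]
    refine Finset.sum_congr rfl fun x _ => ?_
    have hx := x.sum_eq
    rw [sum_insertMany_snd hη T (by omega)]
    -- $T$ as a linear function of the spliced letter alone, so that the sum of $\eta$-terms can be
    -- pulled out.
    set L : M →ₗ[K] A := ((-1 : K) ^ x.leftDeg d) •
      (T (x.left + 1 + x.right)).toLinearMap (x.splice u 0) ⟨x.left, by omega⟩ with hL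
    have h : ∀ m, ((-1 : K) ^ x.leftDeg d) • T (x.left + 1 + x.right) (x.splice u m) = L m := by
      intro m
      rw [x.splice_eq_update u m 0]
      rfl
    simp only [h, map_sum]
    refine Finset.sum_congr rfl fun c _ => Finset.sum_congr rfl fun i _ => ?_
    rw [apply_ite L, map_zero]
  · rw [Finset.sum_apply]
    refine Finset.sum_eq_zero fun k _ => ?_
    cases k with
    | zero => exact (evalList_nil _).2 hΔ
    | succ k => rfl

theorem sum_derivedBracket_arity_zero [DirectSum.Decomposition 𝒜] [DirectSum.Decomposition ℳ]
    [CharZero K] (hμ : IsAInfinityOneAlgebra 𝒜 μ) (hη : IsAInfinityOneBimodule 𝒜 ℳ μ η)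
    (hT : T ∈ homDeg ℳ 𝒜 0) (N : ℕ) :
    (∑ k ∈ Finset.Icc 1 N, ((k.factorial : K)⁻¹) •
      derivedBracket 𝒜 ℳ μ η (List.replicate k (0, T))) 0 = 0 := by
  have hΔ : structureElement μ η 0 = 0 := by
    ext v <;> simp [structureElement, hμ.degree_one.1, hη.degree_one.1]
  ext u
  rw [sum_derivedBracket 𝒜 ℳ hΔ hT.1]
  simp [insertMany, insertSum]

end RotaBaxterIdentity

theorem mainTheorem9 {K A M : Type*} [Field K] [CharZero K]
    [AddCommGroup A] [Module K A] [AddCommGroup M] [Module K M]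
    (𝒜 : ℤ → Submodule K A) [DirectSum.Decomposition 𝒜]
    (ℳ : ℤ → Submodule K M) [DirectSum.Decomposition ℳ]
    (μ : TensorHom K A A) (hμ : IsAInfinityOneAlgebra 𝒜 μ)
    (η : TensorHom K (A × M) M) (hη : IsAInfinityOneBimodule 𝒜 ℳ μ η)
    (T : TensorHom K M A) (hT : T ∈ homDeg ℳ 𝒜 0) :
    IsHomotopyRelRotaBaxter 𝒜 ℳ μ η T ↔
      ∀ p : ℕ, 1 ≤ p → ∀ (d : Fin p → ℤ) (u : Fin p → M), (∀ r, u r ∈ ℳ (d r)) →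
        rotaBaxterLHS μ T p u = rotaBaxterRHS η T p d u := by
  constructor
  · rintro ⟨-, h⟩ p hp d u hu
    -- Membership in $\mathcal F_{p+1}$ is what forces the arity $p$ component to vanish.
    obtain ⟨N, hN, hpN⟩ := ((h (p + 1)).and (eventually_ge_atTop p)).exists
    rw [← sub_eq_zero, ← sum_derivedBracket_eq hμ hη hT hp hpN d u hu, hN p p.lt_succ_self]
    rfl
  · refine fun h => ⟨hT, fun n => ?_⟩
    -- For $k<n\le N$ the arity $k$ component of the partial sum has already stabilized.
    filter_upwards [eventually_ge_atTop n] with N hN k hk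
    rcases Nat.eq_zero_or_pos k with rfl | hk0
    · exact sum_derivedBracket_arity_zero hμ hη hT N
    · refine MultilinearMap.eq_zero_of_homogeneous ℳ _ fun d u hu => ?_
      rw [sum_derivedBracket_eq hμ hη hT hk0 (by omega) d u hu, h k hk0 d u hu, sub_self]
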